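/- **Notation.** Let $m\ge 1$, let $\|\cdot\|_*$ be any norm on $\mathbb R^m$, $d_*(x,S)=\inf_{y\in S}\|x-y\|_*$, $\rho_*(S)=\sup_{x\in\operatorname{span}_{\mathbb R}S}d_*(x,S)$ (covering radius), $R_*=\max\{\|x\|_2:\|x\|_*=1\}$, and for an $m\times n$ matrix $M$ let $\operatorname{disc}_*(M)=\min_{y\in\{\pm1\}^n}\|My\|_*$; $\mathbf 1$ is the all-ones vector and $B(L)$ the closed Euclidean ball of radius $L$ about the origin in $\mathbb R^m$. A lattice $\mathcal L\subset\mathbb R^m$ (a discrete subgroup) is nondegenerate if it spans $\mathbb R^m$ over $\mathbb R$; $\det\mathcal L$ is its covolume and $\mathcal L^*=\{z:\langle z,\lambda\rangle\in\mathbb Z\ \forall\lambda\in\mathcal L\}$ its dual. For a random vector $Z$ on a nondegenerate lattice $\mathcal L'$ with $\mathbb E ZZ^\dagger=I_m$, put $\tilde Z(\theta)=\big(\mathbb E\,|\langle\theta,Z\rangle \bmod 1|^2\big)^{1/2}$, where $y\bmod 1\in(-1/2,1/2]$, and define the spanningness $$s(Z)=\inf\{\tilde Z(\theta):\ \theta\notin\mathcal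 L'^*,\ \tilde Z(\theta)\le \tfrac12 d(\theta,\mathcal L'^*)\}\in[0,\infty],$$ with $d$ the Euclidean distance and $\inf\emptyset=\infty$. **Theorem.** There are absolute constants $c',c,C>0$ such that the following holds. Let $X$ be a random variable on a nondegenerate lattice $\mathcal L\subset\mathbb R^m$ with $\mathcal L=\operatorname{span}_{\mathbb Z}\operatorname{supp}X$, let $\Sigma=\mathbb E[XX^\dagger]$ have least eigenvalue $\sigma$, and suppose $\operatorname{supp}X\subset\Sigma^{1/2}B(L)$. Let $M$ be a random $m\times n$ matrix with independent columns distributed as $X$. If $n\ge N$, where $$N=c'\max\left\{\frac{R_*^2\rho_*(\mathcal L)^2}{\sigma},\ N_0\right\},$$ $$N_0=c\max\left\{m^2L^2(\log m+\log L)^2,\ s(\Sigma^{-1/2}X)^{-4}L^{-2},\ L^2\log^2\frac{\det\mathcal L}{\sqrt{\det\Sigma}}\right\}$$ and $s(\Sigma^{-1/2}X)$ is taken with respect to the lattice $\Sigma^{-1/2}\mathcal L$, then $$\operatorname{disc}_*(M)\le d_*(M\mathbf 1,2\mathcal L)\le 2\rho_*(\mathcal L)$$ with probability at least $1-C\,L\sqrt{\frac{\log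 n}{n}}$. -/

import Mathlib

open MeasureTheory
open scoped ENNReal Matrix MatrixOrder

noncomputable section

/-- Euclidean space `ℝ^m`. -/
abbrev EucSp (m : ℕ) : Type := EuclideanSpace ℝ (Fin m)

/-! ### Norms, distances, discrepancy -/

/-- An arbitrary norm on `ℝ^m`: a definite seminorm. -/
def IsNormOn {m : ℕ} (p : Seminorm ℝ (EucSp m)) : Prop := ∀ x, p x = 0 → x = 0

/-- `d_*(x, S) = inf_{y ∈ S} ‖x - y‖_*`. -/
def normDist {m : ℕ} (p : Seminorm ℝ (EucSp m)) (x : EucSp m) (S : Set (EucSp m)) : ℝ :=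
  ⨅ y : S, p (x - y)

/-- Covering radius `ρ_*(S) = sup_{x ∈ span_ℝ S} d_*(x, S)`, possibly infinite. -/
def coveringRadius {m : ℕ} (p : Seminorm ℝ (EucSp m)) (S : Set (EucSp m)) : ℝ≥0∞ :=
  ⨆ x ∈ Submodule.span ℝ S, ENNReal.ofReal (normDist p x S)

/-- Distortion `R_* = max {‖x‖_2 : ‖x‖_* = 1}`. -/
def distortion {m : ℕ} (p : Seminorm ℝ (EucSp m)) : ℝ :=
  sSup {r : ℝ | ∃ x : EucSp m, p x = 1 ∧ r = ‖x‖}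

/-- `disc_*(M) = min_{y ∈ {±1}^n} ‖M y‖_*`. -/
def starDisc {m n : ℕ} (p : Seminorm ℝ (EucSp m)) (M : Matrix (Fin m) (Fin n) ℝ) : ℝ :=
  ⨅ y : Fin n → ℤˣ, p (WithLp.toLp 2 (M *ᵥ fun j => ((y j : ℤ) : ℝ)))

/-- The set `2Λ`. -/
def doubled {m : ℕ} (Λ : Submodule ℤ (EucSp m)) : Set (EucSp m) :=
  (fun v => (2 : ℝ) • v) '' (Λ : Set (EucSp m))

/-- `d_*(M 1, 2Λ)`, where `1` is the all-ones vector. -/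
def oddDist {m n : ℕ} (p : Seminorm ℝ (EucSp m)) (M : Matrix (Fin m) (Fin n) ℝ)
    (Λ : Submodule ℤ (EucSp m)) : ℝ :=
  normDist p (WithLp.toLp 2 (M *ᵥ fun _ => (1 : ℝ))) (doubled Λ)

/-- The `m × n` matrix with columns `x 0, …, x (n-1)`. -/
def matrixOfColumns {m n : ℕ} (x : Fin n → EucSp m) : Matrix (Fin m) (Fin n) ℝ :=
  Matrix.of fun i j => x j i

/-! ### The random vector `X`, given through its law `P` on `ℝ^m` -/

/-- `Σ = E[X X†]` for `X` with law `P`. -/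
def secondMoment {m : ℕ} (P : Measure (EucSp m)) : Matrix (Fin m) (Fin m) ℝ :=
  Matrix.of fun i j => ∫ x, x i * x j ∂P

/-- `Σ^{1/2}`, the positive semidefinite square root. -/
def sqrtSecondMoment {m : ℕ} (P : Measure (EucSp m)) : Matrix (Fin m) (Fin m) ℝ :=
  CFC.sqrt (secondMoment P)

/-- The least eigenvalue `σ` of `Σ`. -/
def leastEigenvalue {m : ℕ} (P : Measure (EucSp m)) : ℝ := sInf (spectrum ℝ (secondMoment P))

/-- The linear map `Σ^{-1/2}`. -/
def whiten {m : ℕ} (P : Measure (EucSp m)) : EucSp m →ₗ[ℝ] EucSp m :=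
  Matrix.toEuclideanLin (sqrtSecondMoment P)⁻¹

/-- The law of `Z = Σ^{-1/2} X`. -/
def whitenedLaw {m : ℕ} (P : Measure (EucSp m)) : Measure (EucSp m) := P.map (whiten P)

/-- The lattice `Σ^{-1/2} Λ` on which `Z = Σ^{-1/2} X` lives. -/
def whitenedLattice {m : ℕ} (P : Measure (EucSp m)) (Λ : Submodule ℤ (EucSp m)) :
    Submodule ℤ (EucSp m) :=
  Λ.map ((whiten P).restrictScalars ℤ)

/-! ### Spanningness -/

/-- The dual lattice `Λ^* = {z : ⟨z, v⟩ ∈ ℤ for all v ∈ Λ}`. -/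
def dualLattice {m : ℕ} (Λ : Submodule ℤ (EucSp m)) : Set (EucSp m) :=
  {z | ∀ v ∈ Λ, ∃ k : ℤ, inner ℝ z v = (k : ℝ)}

/-- `y mod 1`, taken in `(-1/2, 1/2]`. -/
def modOne (y : ℝ) : ℝ := toIocMod one_pos (-(1 / 2) : ℝ) y

/-- `Z̃(θ) = (E |⟨θ, Z⟩ mod 1|²)^{1/2}` for `Z` with law `Q`. -/
def tildeFn {m : ℕ} (Q : Measure (EucSp m)) (θ : EucSp m) : ℝ :=
  Real.sqrt (∫ z, |modOne (inner ℝ θ z)| ^ 2 ∂Q)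

/-- `θ` is pseudodual if `Z̃(θ) ≤ d(θ, Λ^*) / 2`. -/
def IsPseudodual {m : ℕ} (Q : Measure (EucSp m)) (Λ : Submodule ℤ (EucSp m)) (θ : EucSp m) :
    Prop :=
  tildeFn Q θ ≤ Metric.infDist θ (dualLattice Λ) / 2

/-- The spanningness `s(Z) ∈ [0, ∞]` of an isotropic `Z` with law `Q` on the lattice `Λ`: the
infimum of `Z̃(θ)` over all pseudodual `θ ∉ Λ^*`. -/
def spanningness {m : ℕ} (Q : Measure (EucSp m)) (Λ : Submodule ℤ (EucSp m)) : ℝ≥0∞ :=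
  ⨅ θ ∈ {θ : EucSp m | θ ∉ dualLattice Λ ∧ IsPseudodual Q Λ θ}, ENNReal.ofReal (tildeFn Q θ)

/-! ### The thresholds for the number of columns -/

/-- `N₀(m, s, L, D) = c · max {m² L² (log m + log L)², s⁻⁴ L⁻², L² log² D}`. -/
def thresholdZero (c : ℝ) (m : ℕ) (s : ℝ≥0∞) (L D : ℝ) : ℝ≥0∞ :=
  ENNReal.ofReal c *
    max (ENNReal.ofReal ((m : ℝ) ^ 2 * L ^ 2 * (Real.log m + Real.log L) ^ 2))
      (max (s⁻¹ ^ 4 * ENNReal.ofReal (L⁻¹ ^ 2)) (ENNReal.ofReal (L ^ 2 * Real.log D ^ 2)))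

/-- `N = c' · max {R_*² ρ_*(Λ)² / σ, N₀(m, s(Σ^{-1/2} X), L, det Λ / √(det Σ))}`, where `N₀` has
the constant `c`. -/
def threshold (c' c : ℝ) {m : ℕ} (p : Seminorm ℝ (EucSp m)) (P : Measure (EucSp m))
    (Λ : Submodule ℤ (EucSp m)) (L : ℝ) : ℝ≥0∞ :=
  ENNReal.ofReal c' *
    max (ENNReal.ofReal (distortion p ^ 2 / leastEigenvalue P) *
        coveringRadius p (Λ : Set (EucSp m)) ^ 2)
      (thresholdZero c m (spanningness (whitenedLaw P) (whitenedLattice P Λ)) L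
        (ZLattice.covolume Λ / Real.sqrt (secondMoment P).det))

end

/-!
Let `z₁, …, zₙ` be the whitened columns, `zᵢ = Σ^{-1/2} xᵢ`, which lie on the lattice
`Σ^{-1/2} Λ`, have norm at most `L` and satisfy `E z zᵀ = I`. The heart of the matter is
`exists_signs_whitened`: outside an event of probability `O(L / √n)`, *every* vector `v` of the coset
`∑ zᵢ + 2 Σ^{-1/2} Λ` with `‖v‖² ≤ n / 10` is a signed sum `∑ ± zᵢ`. Almost nearest points of `M 1`
in `2 Λ` give such vectors: a vector of `*`-norm about `2 ρ_*` has whitened Euclidean norm at most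
about `2 R_* ρ_* / √σ`, which the threshold keeps far below `√n`.

To reach `v`, one counts signs by Fourier inversion: the number of solutions of `∑ ± zᵢ = v` is a
positive multiple of the integral of `∏ cos (π ⟨θ, zᵢ⟩) · cos (π ⟨θ, v⟩)` over a fundamental domain
of the dual lattice (`exists_signs_of_integral_ne_zero`). Isotropy forces nonzero dual vectors to have
norm at least `1 / L`, so that the fundamental domain can be chosen to contain the ball of radius
`1 / (4 L)` (`exists_fundamentalDomain_ball`).

* On the ball, the product of cosines is compared with the Gaussian
  `exp (-(π² / 2) ∑ ⟨θ, zᵢ⟩²)`, whose Fourier transform is explicit; this gives a lower bound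
  `(π n)^{-m/2} / 2` (`local_lower_bound`) as soon as `∑ zᵢ zᵢᵀ` is within `n / 2` of `n I` in Frobenius
  norm. By Chebyshev's inequality this holds with probability at least
  `1 - 4 L² m / n` (`measure_frobeniusDeviation_ge`), which suffices because `n ≥ c m² L²`.
* Off the ball, the integral of `∏ |cos (π ⟨θ, zᵢ⟩)|` has expectation at most
  `exp (-2 n τ) / det`, where `τ` is a lower bound for `Z̃(θ)²`: if `θ` is pseudodual, the spanningness
  bounds `Z̃(θ)`, otherwise `Z̃(θ) > d(θ, Λ^*) / 2 ≥ 1 / (8 L)`. Markov's inequality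
  (`measure_lintegral_prod_cos_ge`) and the numerical estimate `exp_mul_rpow_le` make this negligible
  against `(π n)^{-m/2}`.

The logarithmic terms of the threshold may all vanish, for instance when `m = L = 1`. That `n` is
nevertheless larger than a given constant follows from the covering radius: if it is small, then so
is the covolume `D`, and the term `L² log² D` is at least `1` (`one_le_abs_log_of_cover`).
-/

open Real Module

/-! ### Gaussian integrals and bounds for the cosine -/

section
variable {E : Type*} [NormedAddCommGroup E] [InnerProductSpace ℝ E] [FiniteDimensional ℝ E]
  [MeasurableSpace E] [BorelSpace E]

theorem integrable_exp_mul_cos {t : ℝ} (ht : 0 < t) (w : E) :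
    Integrable fun θ : E => exp (-t * ‖θ‖ ^ 2) * cos (inner ℝ w θ) := by
  have h := (GaussianFourier.integrable_cexp_neg_mul_sq_norm_add (V := E) (b := (t : ℂ))
    (by simpa using ht) Complex.I w).re
  refine h.congr (Filter.Eventually.of_forall fun θ => ?_)
  simp only [RCLike.re_to_complex]
  rw [Complex.exp_re]
  simp [← Complex.ofReal_pow, ← Complex.ofReal_neg]

theorem integral_exp_mul_cos {t : ℝ} (ht : 0 < t) (w : E) :
    ∫ θ : E, exp (-t * ‖θ‖ ^ 2) * cos (inner ℝ w θ) =
      (π / t) ^ (Module.finrank ℝ E / 2 : ℝ) * exp (-‖w‖ ^ 2 / (4 * t)) := by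
  have h := GaussianFourier.integral_cexp_neg_mul_sq_norm_add (V := E) (b := (t : ℂ))
    (by simpa using ht) Complex.I w
  have hi := GaussianFourier.integrable_cexp_neg_mul_sq_norm_add (V := E) (b := (t : ℂ))
    (by simpa using ht) Complex.I w
  have h2 := congrArg Complex.re h
  rw [← RCLike.re_to_complex, ← integral_re hi] at h2
  have h3 : ((π : ℂ) / t) ^ (Module.finrank ℝ E / 2 : ℂ) *
      Complex.exp (Complex.I ^ 2 * ‖w‖ ^ 2 / (4 * t)) =
      (((π / t) ^ (Module.finrank ℝ E / 2 : ℝ) * exp (-‖w‖ ^ 2 / (4 * t)) : ℝ) : ℂ) := by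
    rw [Complex.ofReal_mul, Complex.ofReal_cpow (by positivity), Complex.ofReal_exp]
    push_cast
    simp
  rw [h3, Complex.ofReal_re] at h2
  rw [← h2]
  congr 1
  ext θ
  simp only [RCLike.re_to_complex]
  rw [Complex.exp_re]
  simp [← Complex.ofReal_pow, ← Complex.ofReal_neg]

/-- A linear change of variables, without integrability assumption. -/
theorem integral_comp_linearEquiv (B : E ≃ₗ[ℝ] E) (g : E → ℝ) :
    ∫ θ, g (B θ) = |LinearMap.det (B : E →ₗ[ℝ] E)|⁻¹ * ∫ θ, g θ := by
  have hdet : LinearMap.det (B : E →ₗ[ℝ] E) ≠ 0 := B.isUnit_det'.ne_zero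
  have h := Measure.map_linearMap_addHaar_eq_smul_addHaar (volume : Measure E) hdet
  have he : MeasurableEmbedding (B : E → E) :=
    B.toContinuousLinearEquiv.toHomeomorph.measurableEmbedding
  have h2 := he.integral_map (μ := volume) g
  rw [← h2]
  have : Measure.map (B : E → E) volume = Measure.map (B : E →ₗ[ℝ] E) volume := rfl
  rw [this, h, integral_smul_measure]
  simp [abs_inv]

theorem integrable_comp_linearEquiv (B : E ≃ₗ[ℝ] E) {g : E → ℝ} (hg : Integrable g) :
    Integrable fun θ => g (B θ) := by
  have hdet : LinearMap.det (B : E →ₗ[ℝ] E) ≠ 0 := B.isUnit_det'.ne_zero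
  have h := Measure.map_linearMap_addHaar_eq_smul_addHaar (volume : Measure E) hdet
  have he : MeasurableEmbedding (B : E → E) :=
    B.toContinuousLinearEquiv.toHomeomorph.measurableEmbedding
  have : Measure.map (B : E → E) volume = Measure.map (B : E →ₗ[ℝ] E) volume := rfl
  refine (he.integrable_map_iff (μ := volume) (g := g)).1 ?_
  rw [this, h]
  exact hg.smul_measure ENNReal.ofReal_ne_top

theorem cos_le_exp_neg_sq_div_two {x : ℝ} (hx : |x| ≤ 1) : cos x ≤ exp (-(x ^ 2 / 2)) := by
  have h1 := (abs_le.1 (Real.cos_bound hx)).2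
  have hx2 : x ^ 2 ≤ 1 := by rw [← sq_abs]; exact pow_le_one₀ (abs_nonneg x) hx
  set u := x ^ 2 / 2 with hu
  have hu0 : 0 ≤ u := by positivity
  have hu1 : u ≤ 1 / 2 := by linarith
  have h2 := (abs_le.1 (Real.exp_bound (x := -u) (by rw [abs_neg, abs_of_nonneg hu0]; linarith)
    (n := 3) (by norm_num))).1
  rw [abs_neg, abs_of_nonneg hu0] at h2
  simp [Finset.sum_range_succ, Nat.factorial] at h2
  have h3 : |x| ^ 4 = 4 * u ^ 2 := by
    rw [show |x| ^ 4 = (|x| ^ 2) ^ 2 by ring, sq_abs, hu]; ring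
  rw [h3] at h1
  nlinarith [mul_nonneg (sq_nonneg u) (sub_nonneg.2 hu1)]

theorem exp_le_one_sub {u : ℝ} (h0 : 0 ≤ u) (h1 : u ≤ 1 / 2) : exp (-(u + u ^ 2)) ≤ 1 - u := by
  have h := Real.quadratic_le_exp_of_nonneg (x := u + u ^ 2) (by positivity)
  rw [exp_neg, inv_le_comm₀ (exp_pos _) (by linarith)]
  refine le_trans ?_ h
  rw [inv_le_iff_one_le_mul₀ (by linarith)]
  have h3 : u ^ 2 ≤ 1 / 2 * u := by nlinarith
  have : 0 ≤ u ^ 2 * (1 - u - u ^ 2 - u ^ 3) := by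
    apply mul_nonneg (sq_nonneg u)
    nlinarith
  nlinarith

theorem exp_le_cos {x : ℝ} (hx : |x| ≤ 1) : exp (-(x ^ 2 / 2) - x ^ 4 / 4) ≤ cos x := by
  have hx2 : x ^ 2 ≤ 1 := by rw [← sq_abs]; exact pow_le_one₀ (abs_nonneg x) hx
  have h := exp_le_one_sub (u := x ^ 2 / 2) (by positivity) (by linarith)
  refine le_trans (le_of_eq ?_) (h.trans (Real.one_sub_sq_div_two_le_cos))
  congr 1; ring

end

/-! ### The contribution of a ball to the inversion integral -/

section
variable {E : Type*} [NormedAddCommGroup E] [InnerProductSpace ℝ E] [FiniteDimensional ℝ E]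
  [MeasurableSpace E] [BorelSpace E]

/-- The functional `⟨v, ·⟩` in the coordinates `B θ`. -/
theorem exists_inner_comp_eq {E : Type*} [NormedAddCommGroup E] [InnerProductSpace ℝ E]
    [FiniteDimensional ℝ E] (B : E ≃ₗ[ℝ] E) {κ : ℝ} (hκ : 0 < κ)
    (hlow : ∀ θ, κ * ‖θ‖ ^ 2 ≤ ‖B θ‖ ^ 2) (v : E) :
    ∃ w : E, (∀ θ, inner ℝ w (B θ) = inner ℝ v θ) ∧ ‖w‖ ^ 2 ≤ ‖v‖ ^ 2 / κ := by
  refine ⟨LinearMap.adjoint (B.symm : E →ₗ[ℝ] E) v, fun θ => ?_, ?_⟩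
  · rw [LinearMap.adjoint_inner_left]; simp
  · set w := LinearMap.adjoint (B.symm : E →ₗ[ℝ] E) v with hw
    have h1 : ‖w‖ ^ 2 ≤ ‖v‖ * ‖B.symm w‖ := by
      rw [← real_inner_self_eq_norm_sq]
      conv_lhs => rw [hw, LinearMap.adjoint_inner_left]
      exact real_inner_le_norm _ _
    have h2 : κ * ‖B.symm w‖ ^ 2 ≤ ‖w‖ ^ 2 := by simpa using hlow (B.symm w)
    rw [le_div_iff₀ hκ]
    rcases (norm_nonneg w).eq_or_lt with h0 | h0
    · rw [← h0]; simp
    · have h3 : (‖w‖ ^ 2) ^ 2 ≤ (‖v‖ * ‖B.symm w‖) ^ 2 := by gcongr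
      have h4 : ‖w‖ ^ 2 * (‖w‖ ^ 2 * κ) ≤ ‖w‖ ^ 2 * ‖v‖ ^ 2 := by
        have := mul_le_mul_of_nonneg_left h2 (sq_nonneg ‖v‖)
        have := mul_le_mul_of_nonneg_left h3 hκ.le
        nlinarith
      exact le_of_mul_le_mul_left h4 (by positivity)

theorem integral_exp_comp_mul_cos (B : E ≃ₗ[ℝ] E) {t : ℝ} (ht : 0 < t) {v w : E}
    (hw : ∀ θ, inner ℝ w (B θ) = inner ℝ v θ) :
    ∫ θ : E, exp (-t * ‖B θ‖ ^ 2) * cos (inner ℝ v θ) =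
      |LinearMap.det (B : E →ₗ[ℝ] E)|⁻¹ *
        ((π / t) ^ (Module.finrank ℝ E / 2 : ℝ) * exp (-‖w‖ ^ 2 / (4 * t))) := by
  rw [← integral_exp_mul_cos ht w,
    ← integral_comp_linearEquiv B fun θ => exp (-t * ‖θ‖ ^ 2) * cos (inner ℝ w θ)]
  simp_rw [hw]

theorem integrable_exp_comp_mul_cos (B : E ≃ₗ[ℝ] E) {t : ℝ} (ht : 0 < t) {v w : E}
    (hw : ∀ θ, inner ℝ w (B θ) = inner ℝ v θ) :
    Integrable fun θ : E => exp (-t * ‖B θ‖ ^ 2) * cos (inner ℝ v θ) := by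
  have := integrable_comp_linearEquiv B (integrable_exp_mul_cos ht w)
  simpa only [hw] using this

/-- On a small ball the product of cosines is the Gaussian of the same quadratic form, up to
the relative error `(π⁴ / 4) L² ‖θ‖² ∑ ⟨θ, zᵢ⟩²`. -/
theorem prod_cos_bounds {E : Type*} [NormedAddCommGroup E] [InnerProductSpace ℝ E]
    {ι : Type*} [Fintype ι] (z : ι → E) {L : ℝ} (hz : ∀ i, ‖z i‖ ≤ L)
    (hL : 0 < L) {θ : E} (hθ : ‖θ‖ ≤ 1 / (4 * L)) :
    exp (-(π ^ 2 / 2) * ∑ i, inner ℝ θ (z i) ^ 2) *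
        (1 - π ^ 4 / 4 * L ^ 2 * ‖θ‖ ^ 2 * ∑ i, inner ℝ θ (z i) ^ 2) ≤
        ∏ i, cos (π * inner ℝ θ (z i)) ∧
      ∏ i, cos (π * inner ℝ θ (z i)) ≤ exp (-(π ^ 2 / 2) * ∑ i, inner ℝ θ (z i) ^ 2) := by
  have hin : ∀ i, |inner ℝ θ (z i)| ≤ ‖θ‖ * L := fun i =>
    (abs_real_inner_le_norm _ _).trans (by gcongr; exact hz i)
  have hsm : ∀ i, |π * inner ℝ θ (z i)| ≤ 1 := fun i => by
    rw [abs_mul, abs_of_pos pi_pos]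
    have h1 : ‖θ‖ * L ≤ 1 / 4 := by
      calc ‖θ‖ * L ≤ 1 / (4 * L) * L := by gcongr
        _ = 1 / 4 := by field_simp
    have := pi_le_four
    nlinarith [hin i, pi_pos, abs_nonneg (inner ℝ θ (z i))]
  constructor
  · calc _ ≤ exp (-(π ^ 2 / 2) * ∑ i, inner ℝ θ (z i) ^ 2) *
        exp (-(π ^ 4 / 4 * L ^ 2 * ‖θ‖ ^ 2 * ∑ i, inner ℝ θ (z i) ^ 2)) := by
          gcongr
          exact one_sub_le_exp_neg _
      _ = ∏ i, exp (-(π ^ 2 / 2) * inner ℝ θ (z i) ^ 2 -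
            π ^ 4 / 4 * L ^ 2 * ‖θ‖ ^ 2 * inner ℝ θ (z i) ^ 2) := by
          rw [← exp_add, ← exp_sum, Finset.mul_sum, Finset.mul_sum, ← sub_eq_add_neg,
            Finset.sum_sub_distrib]
      _ ≤ _ := by
          refine Finset.prod_le_prod (fun i _ => (exp_pos _).le) fun i _ => ?_
          refine le_trans (exp_le_exp.2 ?_) (exp_le_cos (hsm i))
          have h2 : inner ℝ θ (z i) ^ 2 ≤ (‖θ‖ * L) ^ 2 := by
            rw [← sq_abs]; gcongr; exact hin i
          have h3 := mul_le_mul_of_nonneg_left h2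
            (show 0 ≤ π ^ 4 / 4 * inner ℝ θ (z i) ^ 2 by positivity)
          nlinarith
  · rw [Finset.mul_sum, exp_sum]
    refine Finset.prod_le_prod (fun i _ => cos_nonneg_of_mem_Icc ?_) fun i _ => ?_
    · have := abs_le.1 (hsm i)
      have := pi_gt_three
      constructor <;> linarith
    · refine (cos_le_exp_neg_sq_div_two (hsm i)).trans (le_of_eq ?_)
      congr 1; ring

/-- Replacing `A` by `(1 - 1 / (2 d)) A` in the exponent at most doubles a `d`-dimensional
Gaussian integral. -/
theorem rpow_one_sub_inv_two_mul (d : ℕ) (hd : 1 ≤ d) :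
    (1 / 2 : ℝ) ≤ (1 - 1 / (2 * d) : ℝ) ^ ((d : ℝ) / 2) := by
  have hd' : (1 : ℝ) ≤ d := by exact_mod_cast hd
  have h1 : 1 / (2 * (d : ℝ)) ≤ 1 / 2 := by
    apply one_div_le_one_div_of_le <;> linarith
  have h0 : 0 < 1 / (2 * (d : ℝ)) := by positivity
  have h2 := one_add_mul_le_pow (a := -(1 / (2 * (d : ℝ)))) (by linarith) d
  calc (1 / 2 : ℝ) = 1 + d * -(1 / (2 * (d : ℝ))) := by field_simp; ring
    _ ≤ (1 - 1 / (2 * d) : ℝ) ^ (d : ℝ) := by rw [rpow_natCast, sub_eq_add_neg]; exact h2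
    _ ≤ _ := rpow_le_rpow_of_exponent_ge (by linarith) (by linarith) (by linarith)

/-- The fourth order error and the indicator of the complement of the ball, the latter majorized by
`16 L² ‖θ‖²`, are absorbed by a slightly flatter Gaussian. Here `A` stands for the quadratic form
and `T` for `‖θ‖²`. -/
theorem gaussian_error_le {d n L A T : ℝ} (hd : 1 ≤ d) (hn : 0 < n)
    (hnL : 1000 * d ^ 2 * L ^ 2 ≤ n) (hA0 : 0 ≤ A) (hlow : n / 2 * T ≤ A) :
    exp (-(π ^ 2 / 2) * A) * (π ^ 4 / 4 * L ^ 2 * T * A + T * (16 * L ^ 2)) ≤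
      29 / 1000 * exp (-(π ^ 2 / 2 * (1 - 1 / (2 * d))) * A) := by
  set a := π ^ 2 / 2 with ha
  have ha0 : 0 < a := by positivity
  set y := a * A / (2 * d) with hy
  have hsplit : exp (-(a * (1 - 1 / (2 * d))) * A) = exp (-a * A) * exp y := by
    rw [← exp_add, hy]; congr 1; field_simp; ring
  have hy0 : 0 ≤ y := by positivity
  have hAy : A = 4 * d / π ^ 2 * y := by rw [hy, ha]; field_simp; norm_num
  have hey := Real.quadratic_le_exp_of_nonneg hy0
  have hθ : T ≤ 2 * A / n := by
    rw [le_div_iff₀ hn]; linarith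
  have hpi : 9 ≤ π ^ 2 := by nlinarith [pi_gt_three]
  have hLn : d ^ 2 * L ^ 2 / n ≤ 1 / 1000 := by
    rw [div_le_iff₀ hn]; linarith
  have hLn1 : d * L ^ 2 / n ≤ 1 / 1000 := by
    refine le_trans ?_ hLn
    gcongr
    nlinarith
  have hmain : π ^ 4 / 4 * L ^ 2 * T * A + T * (16 * L ^ 2) ≤ 29 / 1000 * exp y := by
    calc π ^ 4 / 4 * L ^ 2 * T * A + T * (16 * L ^ 2)
        ≤ π ^ 4 / 4 * L ^ 2 * (2 * A / n) * A + (2 * A / n) * (16 * L ^ 2) := by gcongr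
      _ = 8 * (d ^ 2 * L ^ 2 / n) * y ^ 2 + (d * L ^ 2 / n) * (128 / π ^ 2) * y := by
          rw [hAy]; field_simp; ring
      _ ≤ 8 * (1 / 1000) * y ^ 2 + (1 / 1000) * (128 / 9) * y := by gcongr
      _ ≤ 29 / 1000 * exp y := by nlinarith
  calc exp (-a * A) * (π ^ 4 / 4 * L ^ 2 * T * A + T * (16 * L ^ 2))
      ≤ exp (-a * A) * (29 / 1000 * exp y) := by gcongr
    _ = _ := by rw [hsplit]; ring

/-- Both bounds on `p` are needed, since the oscillating factor `c` may have either sign. -/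
theorem mul_sub_le_mul_of_bounds {G err p c : ℝ} (hG : 0 ≤ G * err) (hl : G * (1 - err) ≤ p)
    (hu : p ≤ G) (hc : c ≤ 1) : G * c - G * err ≤ p * c := by
  rcases le_total 0 c with h0 | h0
  · have h1 := mul_le_mul_of_nonneg_right hl h0
    have h2 := mul_le_mul_of_nonneg_left hc hG
    linarith
  · have h1 := mul_le_mul_of_nonpos_right hu h0
    linarith

/-- The part of the inversion integral over the ball of radius `1 / (4 L)`, where the quadratic form
`∑ ⟨θ, zᵢ⟩²` is given as `‖B θ‖²`. -/
theorem local_lower_bound (hd : 1 ≤ Module.finrank ℝ E) {n : ℕ} (hn : 0 < n) (z : Fin n → E)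
    (B : E ≃ₗ[ℝ] E) (hB : ∀ θ, ‖B θ‖ ^ 2 = ∑ i, inner ℝ θ (z i) ^ 2)
    (hlow : ∀ θ, (n / 2 : ℝ) * ‖θ‖ ^ 2 ≤ ‖B θ‖ ^ 2) (hup : ∀ θ, ‖B θ‖ ^ 2 ≤ 2 * n * ‖θ‖ ^ 2)
    {L : ℝ} (hL : 0 < L) (hz : ∀ i, ‖z i‖ ≤ L)
    (hnL : 1000 * (Module.finrank ℝ E : ℝ) ^ 2 * L ^ 2 ≤ n) {v : E} (hv : ‖v‖ ^ 2 ≤ n / 10) :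
    1 / 2 * (1 / (π * n)) ^ (Module.finrank ℝ E / 2 : ℝ) ≤
      ∫ θ in Metric.ball (0 : E) (1 / (4 * L)),
        (∏ i, cos (π * inner ℝ θ (z i))) * cos (π * inner ℝ θ v) := by
  set d := Module.finrank ℝ E with hd_def
  have hd' : (1 : ℝ) ≤ d := by exact_mod_cast hd
  have hn' : (0 : ℝ) < n := by exact_mod_cast hn
  set β : ℝ := 1 - 1 / (2 * d) with hβ
  have hd0 : 0 < 1 / (2 * (d : ℝ)) := by positivity
  have hd1 : 1 / (2 * (d : ℝ)) ≤ 1 / 2 := by apply one_div_le_one_div_of_le <;> linarith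
  have hβ0 : 0 < β := by linarith
  set a : ℝ := π ^ 2 / 2 with ha
  have ha0 : 0 < a := by positivity
  obtain ⟨w, hw, hwn⟩ := exists_inner_comp_eq B (κ := n / 2) (by positivity) hlow (π • v)
  have hw0 : ∀ θ, inner ℝ (0 : E) (B θ) = inner ℝ (0 : E) θ := by simp
  have I1 := integrable_exp_comp_mul_cos B ha0 hw
  have E1 := integral_exp_comp_mul_cos B ha0 hw
  have I2 := integrable_exp_comp_mul_cos B (mul_pos ha0 hβ0) hw0
  have E2 := integral_exp_comp_mul_cos B (mul_pos ha0 hβ0) hw0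
  have I3 := integrable_exp_comp_mul_cos B ha0 hw0
  have E3 := integral_exp_comp_mul_cos B ha0 hw0
  simp only [inner_zero_left, cos_zero, mul_one, norm_zero] at I2 E2 I3 E3
  rw [← hd_def] at E1 E2 E3
  simp only [zero_pow two_ne_zero, neg_zero, zero_div, exp_zero, mul_one] at E2 E3
  set g : ℝ := |LinearMap.det (B : E →ₗ[ℝ] E)|⁻¹ * (π / a) ^ (d / 2 : ℝ) with hg
  have hg0 : 0 ≤ g := by positivity
  -- the size of the Gaussian integral
  have hgl : (1 / (π * n)) ^ (d / 2 : ℝ) ≤ g := by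
    have E4 := integral_exp_mul_cos (E := E) (t := 2 * a * n) (by positivity) 0
    have I4 := integrable_exp_mul_cos (E := E) (t := 2 * a * n) (by positivity) 0
    simp only [inner_zero_left, cos_zero, mul_one, norm_zero] at I4 E4
    simp only [zero_pow two_ne_zero, neg_zero, zero_div, exp_zero, mul_one] at E4
    rw [← hd_def] at E4
    rw [show 1 / (π * n) = π / (2 * a * n) by rw [ha]; field_simp, ← E4, ← E3]
    refine integral_mono I4 I3 fun θ => exp_le_exp.2 ?_
    have := mul_le_mul_of_nonneg_left (hup θ) ha0.le
    nlinarith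
  -- the perturbation of the Gaussian by a slightly flatter one
  have h2le : ∫ θ, exp (-(a * β) * ‖B θ‖ ^ 2) ≤ 2 * g := by
    rw [E2, show π / (a * β) = (π / a) / β by field_simp, div_rpow (by positivity) hβ0.le,
      ← mul_div_assoc, ← hg, div_le_iff₀ (by positivity)]
    calc g = 2 * (g * (1 / 2)) := by ring
      _ ≤ 2 * (g * β ^ (d / 2 : ℝ)) := by
          gcongr
          exact rpow_one_sub_inv_two_mul d hd
      _ = _ := by ring
  have h1ge : 9 / 10 * g ≤ ∫ θ, exp (-a * ‖B θ‖ ^ 2) * cos (inner ℝ (π • v) θ) := by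
    rw [E1, mul_comm (9 / 10) g, show |LinearMap.det (B : E →ₗ[ℝ] E)|⁻¹ * ((π / a) ^ (d / 2 : ℝ) *
      exp (-‖w‖ ^ 2 / (4 * a))) = g * exp (-‖w‖ ^ 2 / (4 * a)) by rw [hg, mul_assoc]]
    refine mul_le_mul_of_nonneg_left ?_ hg0
    refine le_trans ?_ (add_one_le_exp _)
    have h5 : ‖w‖ ^ 2 ≤ π ^ 2 / 5 := by
      refine hwn.trans ?_
      rw [div_le_iff₀ (by positivity), norm_smul, mul_pow, norm_eq_abs, sq_abs]
      calc π ^ 2 * ‖v‖ ^ 2 ≤ π ^ 2 * (n / 10) := by gcongr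
        _ = π ^ 2 / 5 * (n / 2) := by ring
    have h6 : ‖w‖ ^ 2 / (4 * a) ≤ 1 / 10 := by
      rw [div_le_iff₀ (by positivity), ha]; linarith
    rw [neg_div]
    generalize ‖w‖ ^ 2 / (4 * a) = x at h6 ⊢
    linarith
  set F : E → ℝ := fun θ => (∏ i, cos (π * inner ℝ θ (z i))) * cos (π * inner ℝ θ v) with hF
  set H : E → ℝ := fun θ => exp (-a * ‖B θ‖ ^ 2) * cos (inner ℝ (π • v) θ) -
    29 / 1000 * exp (-(a * β) * ‖B θ‖ ^ 2) with hH
  have hHi : Integrable H := I1.sub (I2.const_mul _)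
  have hkey : ∀ θ, exp (-a * ‖B θ‖ ^ 2) *
      (π ^ 4 / 4 * L ^ 2 * ‖θ‖ ^ 2 * ‖B θ‖ ^ 2 + ‖θ‖ ^ 2 * (16 * L ^ 2)) ≤
      29 / 1000 * exp (-(a * β) * ‖B θ‖ ^ 2) :=
    fun θ => gaussian_error_le hd' hn' hnL (by positivity) (hlow θ)
  have hFH : ∀ θ ∈ Metric.ball (0 : E) (1 / (4 * L)), H θ ≤ F θ := by
    intro θ hθ
    have hθ' : ‖θ‖ ≤ 1 / (4 * L) := (mem_ball_zero_iff.1 hθ).le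
    obtain ⟨hl, hu⟩ := prod_cos_bounds z hz hL hθ'
    rw [← hB] at hl hu
    simp only [hH, hF]
    rw [show inner ℝ (π • v) θ = π * inner ℝ θ v by rw [real_inner_smul_left, real_inner_comm]]
    set c := cos (π * inner ℝ θ v)
    have hc1 : c ≤ 1 := cos_le_one _
    have hc2 : -1 ≤ c := neg_one_le_cos _
    have hk := hkey θ
    set G := exp (-a * ‖B θ‖ ^ 2) with hG
    have hG0 : 0 < G := exp_pos _
    have herr0 : 0 ≤ G * (π ^ 4 / 4 * L ^ 2 * ‖θ‖ ^ 2 * ‖B θ‖ ^ 2) := by positivity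
    have hk2 : 0 ≤ G * (‖θ‖ ^ 2 * (16 * L ^ 2)) := by positivity
    have := mul_sub_le_mul_of_bounds herr0 hl hu hc1
    linarith
  have hHneg : ∀ θ ∉ Metric.ball (0 : E) (1 / (4 * L)), H θ ≤ 0 := by
    intro θ hθ
    have hθ' : 1 / (4 * L) ≤ ‖θ‖ := by simpa using hθ
    have h16 : 1 ≤ ‖θ‖ ^ 2 * (16 * L ^ 2) := by
      have : (1 / (4 * L)) ^ 2 ≤ ‖θ‖ ^ 2 := by gcongr
      calc (1 : ℝ) = (1 / (4 * L)) ^ 2 * (16 * L ^ 2) := by field_simp; norm_num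
        _ ≤ _ := by gcongr
    simp only [hH]
    have hk := hkey θ
    set G := exp (-a * ‖B θ‖ ^ 2) with hG
    have hG0 : 0 < G := exp_pos _
    have herr0 : 0 ≤ G * (π ^ 4 / 4 * L ^ 2 * ‖θ‖ ^ 2 * ‖B θ‖ ^ 2) := by positivity
    have := mul_le_mul_of_nonneg_left h16 hG0.le
    have := mul_le_mul_of_nonneg_left (cos_le_one (inner ℝ (π • v) θ)) hG0.le
    linarith
  have hFi : IntegrableOn F (Metric.ball (0 : E) (1 / (4 * L))) := by
    refine IntegrableOn.mono_set ?_ Metric.ball_subset_closedBall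
    refine ContinuousOn.integrableOn_compact (isCompact_closedBall _ _) ?_
    exact (by fun_prop : Continuous F).continuousOn
  calc 1 / 2 * (1 / (π * n)) ^ (d / 2 : ℝ) ≤ 1 / 2 * g := by gcongr
    _ ≤ ∫ θ, H θ := by
        rw [hH, integral_sub I1 (I2.const_mul _), integral_const_mul]
        generalize (∫ θ, exp (-(a * β) * ‖B θ‖ ^ 2)) = J at h2le ⊢
        linarith only [h1ge, h2le, hg0]
    _ ≤ ∫ θ in Metric.ball (0 : E) (1 / (4 * L)), H θ := by
        rw [← integral_add_compl Metric.isOpen_ball.measurableSet hHi]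
        have := setIntegral_nonpos (μ := volume) (f := H)
          (Metric.isOpen_ball (x := (0 : E)) (ε := 1 / (4 * L))).measurableSet.compl
          fun θ hθ => hHneg θ hθ
        linarith
    _ ≤ _ := setIntegral_mono_on hHi.integrableOn hFi Metric.isOpen_ball.measurableSet hFH

end

/-! ### Dual lattices, fundamental domains and Fourier inversion -/

section
variable {E : Type*} [NormedAddCommGroup E] [InnerProductSpace ℝ E]
  {ι : Type*} [Fintype ι]

theorem exists_inner_dual_basis [DecidableEq ι] [FiniteDimensional ℝ E] (e : Basis ι ℝ E) :
    ∃ f : Basis ι ℝ E, ∀ i j, inner ℝ (f i) (e j) = if j = i then (1 : ℝ) else 0 := by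
  have hB : LinearMap.BilinForm.Nondegenerate (innerₗ E : LinearMap.BilinForm ℝ E) := by
    refine ⟨fun x hx => ?_, fun x hx => ?_⟩
    · exact inner_self_eq_zero.1 (hx x)
    · exact inner_self_eq_zero.1 (hx x)
  exact ⟨LinearMap.BilinForm.dualBasis (innerₗ E) hB e, fun i j =>
    LinearMap.BilinForm.apply_dualBasis_left hB e i j⟩

theorem repr_eq_inner [DecidableEq ι] {e f : Basis ι ℝ E}
    (hef : ∀ i j, inner ℝ (f i) (e j) = if j = i then (1 : ℝ) else 0) (θ : E) (j : ι) :
    f.repr θ j = inner ℝ θ (e j) := by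
  conv_rhs => rw [← f.sum_repr θ, sum_inner]
  simp only [real_inner_smul_left, hef]
  simp

/-- The dual basis spans the dual lattice. -/
theorem mem_span_dual_iff [DecidableEq ι] {e f : Basis ι ℝ E}
    (hef : ∀ i j, inner ℝ (f i) (e j) = if j = i then (1 : ℝ) else 0) (θ : E) :
    θ ∈ Submodule.span ℤ (Set.range f) ↔
      ∀ v ∈ Submodule.span ℤ (Set.range e), ∃ k : ℤ, inner ℝ θ v = (k : ℝ) := by
  rw [Basis.mem_span_iff_repr_mem]
  constructor
  · intro h v hv
    induction hv using Submodule.span_induction with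
    | mem x hx =>
      obtain ⟨j, rfl⟩ := hx
      obtain ⟨k, hk⟩ := h j
      exact ⟨k, by rw [← repr_eq_inner hef, ← hk]; rfl⟩
    | zero => exact ⟨0, by simp⟩
    | add x y _ _ hx hy =>
      obtain ⟨a, ha⟩ := hx
      obtain ⟨b, hb⟩ := hy
      exact ⟨a + b, by rw [inner_add_right, ha, hb]; push_cast; ring⟩
    | smul c x _ hx =>
      obtain ⟨a, ha⟩ := hx
      exact ⟨c * a, by
        rw [← Int.cast_smul_eq_zsmul ℝ, real_inner_smul_right, ha]; push_cast; ring⟩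
  · intro h j
    obtain ⟨k, hk⟩ := h (e j) (Submodule.subset_span ⟨j, rfl⟩)
    exact ⟨k, by rw [repr_eq_inner hef, hk]; rfl⟩

variable [FiniteDimensional ℝ E] [MeasurableSpace E] [BorelSpace E]

theorem volume_fundamentalDomain_orthonormal (b : OrthonormalBasis ι ℝ E) :
    (volume : Measure E).real (ZSpan.fundamentalDomain b.toBasis) = 1 := by
  rw [measureReal_congr (ZSpan.fundamentalDomain_ae_parallelepiped b.toBasis volume),
    measureReal_def, OrthonormalBasis.coe_toBasis, b.volume_parallelepiped, ENNReal.toReal_one]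

theorem volume_fundamentalDomain_dual [DecidableEq ι] (b : OrthonormalBasis ι ℝ E) {e f : Basis ι ℝ E}
    (hef : ∀ i j, inner ℝ (f i) (e j) = if j = i then (1 : ℝ) else 0) :
    (volume : Measure E).real (ZSpan.fundamentalDomain f) *
      (volume : Measure E).real (ZSpan.fundamentalDomain e) = 1 := by
  rw [ZSpan.measureReal_fundamentalDomain f volume b.toBasis,
    ZSpan.measureReal_fundamentalDomain e volume b.toBasis,
    volume_fundamentalDomain_orthonormal, mul_one, mul_one, ← abs_mul, Basis.det_apply,
    Basis.det_apply, ← Matrix.det_transpose, ← Matrix.det_mul]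
  have : (b.toBasis.toMatrix f)ᵀ * b.toBasis.toMatrix e = 1 := by
    ext i j
    rw [Matrix.mul_apply, Matrix.one_apply]
    have h := b.sum_inner_mul_inner (f i) (e j)
    rw [hef] at h
    simp only [eq_comm (a := j)] at h
    rw [← h]
    refine Finset.sum_congr rfl fun k _ => ?_
    simp [Basis.toMatrix_apply, OrthonormalBasis.repr_apply_apply, real_inner_comm]
  rw [this, Matrix.det_one, abs_one]

open scoped Pointwise in
/-- Nontrivial characters integrate to zero over a fundamental domain: translation by
`w / (2 ‖w‖²)` changes the sign of the integrand. -/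
theorem integral_cos_eq_zero {Λ : Submodule ℤ E} [Countable Λ] {S : Set E}
    (hS : IsAddFundamentalDomain Λ S volume) {w : E} (hw : w ≠ 0)
    (hΛ : ∀ μ ∈ Λ, ∃ k : ℤ, inner ℝ μ w = (k : ℝ)) :
    ∫ θ in S, cos (2 * π * inner ℝ θ w) = 0 := by
  set u : E := (1 / (2 * ‖w‖ ^ 2)) • w with hu
  have huw : inner ℝ u w = (1 / 2 : ℝ) := by
    have : ‖w‖ ≠ 0 := norm_ne_zero_iff.2 hw
    rw [hu, real_inner_smul_left, real_inner_self_eq_norm_sq]; field_simp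
  have h1 : ∫ θ in S, cos (2 * π * inner ℝ θ w) =
      ∫ θ in u +ᵥ S, cos (2 * π * inner ℝ θ w) := by
    have : VAddInvariantMeasure Λ E volume :=
      inferInstanceAs (VAddInvariantMeasure Λ.toAddSubgroup E volume)
    refine hS.setIntegral_eq (hS.vadd_of_comm u) fun g x => ?_
    obtain ⟨k, hk⟩ := hΛ g g.2
    rw [Submodule.vadd_def, vadd_eq_add, inner_add_left, hk, mul_add, add_comm, mul_comm (2 * π) (k : ℝ),
      cos_add_int_mul_two_pi]
  have h2 : ∫ θ in u +ᵥ S, cos (2 * π * inner ℝ θ w) =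
      ∫ θ in S, cos (2 * π * inner ℝ (u + θ) w) := by
    rw [← (measurePreserving_add_left volume u).setIntegral_preimage_emb
      (measurableEmbedding_addLeft u)]
    congr 2
    ext x
    simp [Set.mem_vadd_set]
  have h3 : ∀ θ : E, cos (2 * π * inner ℝ (u + θ) w) = -cos (2 * π * inner ℝ θ w) := fun θ => by
    rw [inner_add_left, huw, ← cos_add_pi]; congr 1; ring
  simp_rw [h3] at h2
  rw [integral_neg] at h2
  linarith

theorem prod_cos_mul_cos {n : ℕ} (x : Fin n → ℝ) (t : ℝ) :
    (∏ i, cos (x i)) * cos t =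
      (1 / 2) ^ n * ∑ y : Fin n → ℤˣ, cos (∑ i, ((y i : ℤ) : ℝ) * x i + t) := by
  have h : (∏ i, Complex.cos (x i)) * Complex.exp (t * Complex.I) =
      (1 / 2) ^ n * ∑ y : Fin n → ℤˣ,
        Complex.exp (((∑ i, ((y i : ℤ) : ℝ) * x i + t : ℝ) : ℂ) * Complex.I) := by
    have h1 : ∀ i, Complex.cos (x i) =
        1 / 2 * ∑ s : ℤˣ, Complex.exp ((((s : ℤ) : ℝ) * x i : ℝ) * Complex.I) := fun i => by
      rw [Complex.cos, show (Finset.univ : Finset ℤˣ) = {1, -1} from rfl,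
        Finset.sum_pair (by decide)]
      simp; ring
    simp_rw [h1]
    rw [Finset.prod_mul_distrib, Finset.prod_const, Finset.card_univ, Fintype.card_fin,
      Finset.prod_univ_sum, mul_assoc, Finset.sum_mul]
    congr 1
    rw [Fintype.piFinset_univ]
    refine Finset.sum_congr rfl fun y _ => ?_
    rw [← Complex.exp_sum, ← Complex.exp_add]
    congr 1
    push_cast
    rw [add_mul, Finset.sum_mul]
  have h2 := congrArg Complex.re h
  have h3 : (∏ i, Complex.cos (x i)) = ((∏ i, cos (x i) : ℝ) : ℂ) := by push_cast; rfl
  have h4 : ((1 : ℂ) / 2) ^ n = (((1 / 2 : ℝ) ^ n : ℝ) : ℂ) := by push_cast; rfl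
  rw [h3, h4, Complex.re_ofReal_mul, Complex.re_ofReal_mul, Complex.re_sum,
    Complex.exp_ofReal_mul_I_re] at h2
  rw [h2]
  simp_rw [Complex.exp_ofReal_mul_I_re]

/-- Fourier inversion: expanding the product of cosines, the integral is a combination of characters
at the lattice vectors `(∑ yᵢ zᵢ + v) / 2`, and it vanishes unless one of these is zero. -/
theorem exists_signs_of_integral_ne_zero {Λ' Λ : Submodule ℤ E} [Countable Λ'] {S : Set E}
    (hS : IsAddFundamentalDomain Λ' S volume) (hSf : volume S ≠ ∞)
    (hdual : ∀ μ ∈ Λ', ∀ w ∈ Λ, ∃ k : ℤ, inner ℝ μ w = (k : ℝ))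
    {n : ℕ} (z : Fin n → E) (hz : ∀ i, z i ∈ Λ) {v u : E} (hu : u ∈ Λ)
    (hv : v = ∑ i, z i - (2 : ℝ) • u)
    (hne : ∫ θ in S, (∏ i, cos (π * inner ℝ θ (z i))) * cos (π * inner ℝ θ v) ≠ 0) :
    ∃ y : Fin n → ℤˣ, ∑ i, ((y i : ℤ) : ℝ) • z i = v := by
  by_contra! hcon
  apply hne
  simp_rw [prod_cos_mul_cos]
  have : Fact (volume S < ∞) := ⟨hSf.lt_top⟩
  rw [integral_const_mul, integral_finsetSum]
  · rw [Finset.sum_eq_zero, mul_zero]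
    intro y _
    -- half of `∑ y i z i + v` is a lattice vector
    have hpar : ∀ i, ∃ k : ℤ, (y i : ℤ) + 1 = 2 * k := fun i => by
      rcases Int.units_eq_one_or (y i) with h | h <;> rw [h]
      · exact ⟨1, by simp⟩
      · exact ⟨0, by simp⟩
    choose k hk using hpar
    set w : E := ∑ i, k i • z i - u with hw
    have hwΛ : w ∈ Λ := Λ.sub_mem (Submodule.sum_mem _ fun i _ => Λ.smul_mem _ (hz i)) hu
    have h2w : (2 : ℝ) • w = ∑ i, ((y i : ℤ) : ℝ) • z i + v := by
      rw [hv, hw, smul_sub, Finset.smul_sum, ← add_sub_assoc, ← Finset.sum_add_distrib]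
      congr 1
      refine Finset.sum_congr rfl fun i _ => ?_
      have : ((y i : ℤ) : ℝ) + 1 = 2 * k i := by exact_mod_cast hk i
      rw [← Int.cast_smul_eq_zsmul ℝ, smul_smul, ← this, add_smul, one_smul]
    have hw0 : w ≠ 0 := by
      intro h0
      rw [h0, smul_zero] at h2w
      apply hcon (-y)
      rw [eq_comm, ← sub_eq_zero, sub_eq_add_neg, ← Finset.sum_neg_distrib, add_comm]
      convert h2w.symm using 3 with i
      simp
    rw [← integral_cos_eq_zero hS hw0 fun μ hμ => hdual μ hμ w hwΛ]
    congr 1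
    ext θ
    congr 1
    have : inner ℝ θ ((2 : ℝ) • w) = inner ℝ θ (∑ i, ((y i : ℤ) : ℝ) • z i + v) := by rw [h2w]
    rw [real_inner_smul_right, inner_add_right, inner_sum] at this
    simp only [real_inner_smul_right] at this
    rw [mul_assoc, mul_left_comm, this, mul_add, Finset.mul_sum]
    congr 1
    exact Finset.sum_congr rfl fun i _ => by ring
  · intro y _
    refine Integrable.mono' (g := fun _ => (1 : ℝ)) (integrable_const _) ?_ ?_
    · exact (by fun_prop : Continuous _).aestronglyMeasurable
    · exact Filter.Eventually.of_forall fun θ => by simpa using abs_cos_le_one _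

/-- A fundamental domain consisting of the ball of radius `r` and the points of a fundamental
parallelepiped at distance at least `r` from the lattice. -/
theorem exists_fundamentalDomain_ball (f : Basis ι ℝ E) {r : ℝ}
    (hr : ∀ μ ∈ Submodule.span ℤ (Set.range f), μ ≠ 0 → 2 * r ≤ ‖μ‖) :
    ∃ S : Set E, IsAddFundamentalDomain (Submodule.span ℤ (Set.range f)) S volume ∧
      MeasurableSet S ∧ Metric.ball 0 r ⊆ S ∧
      S \ Metric.ball 0 r ⊆ {θ ∈ ZSpan.fundamentalDomain f |
        r ≤ Metric.infDist θ (Submodule.span ℤ (Set.range f) : Set E)} := by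
  set Λ := Submodule.span ℤ (Set.range f) with hΛ
  set R : Set E := {θ ∈ ZSpan.fundamentalDomain f | r ≤ Metric.infDist θ (Λ : Set E)} with hR
  have hne : (Λ : Set E).Nonempty := ⟨0, Λ.zero_mem⟩
  have hmeas : MeasurableSet (Metric.ball (0 : E) r ∪ R) := by
    refine Metric.isOpen_ball.measurableSet.union
      ((ZSpan.fundamentalDomain_measurableSet f).inter ?_)
    exact (isClosed_Ici.preimage (Metric.continuous_infDist_pt (Λ : Set E))).measurableSet
  refine ⟨Metric.ball 0 r ∪ R, IsAddFundamentalDomain.mk' hmeas.nullMeasurableSet ?_, hmeas,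
    Set.subset_union_left, by intro x hx; exact hx.1.resolve_left hx.2⟩
  have hinv : ∀ (g : Λ) (x : E), Metric.infDist (g +ᵥ x) (Λ : Set E) =
      Metric.infDist x (Λ : Set E) := by
    have key : ∀ (g : Λ) (x : E), Metric.infDist (g +ᵥ x) (Λ : Set E) ≤
        Metric.infDist x (Λ : Set E) := by
      intro g x
      refine (Metric.le_infDist hne).2 fun {y} hy => ?_
      have h1 := Metric.infDist_le_dist_of_mem (x := g +ᵥ x) (Λ.add_mem g.2 hy)
      rwa [Submodule.vadd_def, vadd_eq_add, dist_add_left] at h1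
    intro g x
    refine le_antisymm (key g x) ?_
    have := key (-g) (g +ᵥ x)
    rwa [neg_vadd_vadd] at this
  intro x
  by_cases hx : Metric.infDist x (Λ : Set E) < r
  · obtain ⟨y, hy, hxy⟩ := (Metric.infDist_lt_iff hne).1 hx
    refine ⟨-⟨y, hy⟩, Or.inl ?_, ?_⟩
    · rw [mem_ball_zero_iff, Submodule.vadd_def, vadd_eq_add]
      rw [dist_eq_norm, ← neg_add_eq_sub] at hxy
      exact hxy
    · intro g hg
      rcases hg with hg | hg
      · by_contra hne'
        rw [mem_ball_zero_iff, Submodule.vadd_def, vadd_eq_add] at hg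
        have h1 := hr ((g : E) + y) (Λ.add_mem g.2 hy) (by
          intro h0
          apply hne'
          ext
          simpa using eq_neg_of_add_eq_zero_left h0)
        have h2 : ‖(g : E) + y‖ ≤ ‖(g : E) + x‖ + dist x y := by
          rw [dist_eq_norm]
          have : (g : E) + y = ((g : E) + x) - (x - y) := by abel
          rw [this]
          exact norm_sub_le _ _
        linarith
      · have := hg.2
        rw [hinv] at this
        linarith
  · obtain ⟨g, hg, huniq⟩ := ZSpan.exist_unique_vadd_mem_fundamentalDomain f x
    refine ⟨g, Or.inr ⟨hg, by rw [hinv]; exact not_lt.1 hx⟩, fun g' hg' => ?_⟩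
    rcases hg' with hg' | hg'
    · exfalso
      apply hx
      rw [← hinv g' x]
      refine lt_of_le_of_lt (Metric.infDist_le_dist_of_mem Λ.zero_mem) ?_
      rwa [Metric.mem_ball] at hg'
    · exact huniq g' hg'.1

end

/-! ### Two large deviation estimates for the random columns -/

section

/-- The squared Frobenius norm of `∑ᵢ zᵢ zᵢᵀ - n I`. -/
def frobeniusDeviation {m n : ℕ} (z : Fin n → EucSp m) : ℝ :=
  ∑ j, ∑ k, (∑ i, (z i j * z i k - if j = k then 1 else 0)) ^ 2

theorem abs_sum_inner_sq_sub_le {m n : ℕ} (z : Fin n → EucSp m)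
    (hz : frobeniusDeviation z < (n : ℝ) ^ 2 / 4) (θ : EucSp m) :
    |∑ i, inner ℝ θ (z i) ^ 2 - n * ‖θ‖ ^ 2| ≤ n / 2 * ‖θ‖ ^ 2 := by
  set c : Fin m × Fin m → ℝ := fun p => ∑ i, (z i p.1 * z i p.2 - if p.1 = p.2 then 1 else 0)
    with hc
  have hθ : ‖θ‖ ^ 2 = ∑ j, θ j ^ 2 := EuclideanSpace.real_norm_sq_eq θ
  have h1 : ∑ i, inner ℝ θ (z i) ^ 2 - n * ‖θ‖ ^ 2 = ∑ p, (θ p.1 * θ p.2) * c p := by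
    have hi : ∀ i, inner ℝ θ (z i) ^ 2 - ‖θ‖ ^ 2 =
        ∑ p : Fin m × Fin m, (θ p.1 * θ p.2) * (z i p.1 * z i p.2 - if p.1 = p.2 then 1 else 0) := by
      intro i
      rw [Fintype.sum_prod_type, PiLp.inner_apply, hθ, sq (∑ j, _), Finset.sum_mul_sum,
        ← Finset.sum_sub_distrib]
      refine Finset.sum_congr rfl fun j _ => ?_
      simp only [mul_sub, Finset.sum_sub_distrib]
      congr 1
      · refine Finset.sum_congr rfl fun k _ => ?_
        simp; ring
      · simp [sq]
    have : ∑ i, inner ℝ θ (z i) ^ 2 - n * ‖θ‖ ^ 2 = ∑ i, (inner ℝ θ (z i) ^ 2 - ‖θ‖ ^ 2) := by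
      rw [Finset.sum_sub_distrib]; simp
    rw [this]
    simp_rw [hi, hc, Finset.mul_sum]
    rw [Finset.sum_comm]
  have h2 : (∑ p, (θ p.1 * θ p.2) * c p) ^ 2 ≤ (n / 2 * ‖θ‖ ^ 2) ^ 2 := by
    refine (Finset.sum_mul_sq_le_sq_mul_sq _ _ _).trans ?_
    have h3 : ∑ p : Fin m × Fin m, (θ p.1 * θ p.2) ^ 2 = (‖θ‖ ^ 2) ^ 2 := by
      rw [hθ, sq (∑ j, _), Finset.sum_mul_sum, Fintype.sum_prod_type]
      simp_rw [mul_pow]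
    have h4 : ∑ p, c p ^ 2 ≤ (n : ℝ) ^ 2 / 4 := by
      rw [Fintype.sum_prod_type]; exact hz.le
    rw [h3]
    nlinarith [mul_le_mul_of_nonneg_left h4 (sq_nonneg (‖θ‖ ^ 2))]
  rw [h1]
  exact abs_le_of_sq_le_sq h2 (by positivity)

/-- Chebyshev's inequality for `∑ zᵢ zᵢᵀ`, using `E ‖z‖⁴ ≤ L² m`. -/
theorem measure_frobeniusDeviation_ge {m n : ℕ} (hn : 0 < n) (Q : Measure (EucSp m))
    [IsProbabilityMeasure Q] {L : ℝ} (hL : 0 ≤ L) (hQL : ∀ᵐ z ∂Q, ‖z‖ ≤ L)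
    (hQ : ∀ j k : Fin m, ∫ z, z j * z k ∂Q = if j = k then 1 else 0) :
    (Measure.pi fun _ : Fin n => Q) {z | (n : ℝ) ^ 2 / 4 ≤ frobeniusDeviation z} ≤
      ENNReal.ofReal (4 * L ^ 2 * m / n) := by
  have hn' : (0 : ℝ) < n := by exact_mod_cast hn
  have hcoord : ∀ᵐ z ∂Q, ∀ j : Fin m, |z j| ≤ L := by
    filter_upwards [hQL] with z hz j
    exact (by simpa using PiLp.norm_apply_le z j : |z j| ≤ ‖z‖).trans hz
  have hmem : ∀ j k : Fin m, MemLp (fun z : EucSp m => z j * z k) 2 Q := fun j k => by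
    refine MemLp.of_bound (by fun_prop) (L * L) ?_
    filter_upwards [hcoord] with z hz
    rw [norm_eq_abs, abs_mul]
    gcongr
    exacts [hz j, hz k]
  have hint2 : ∀ j k : Fin m, Integrable (fun z : EucSp m => (z j * z k) ^ 2) Q :=
    fun j k => (hmem j k).integrable_sq
  set φ : Fin m → Fin m → EucSp m → ℝ := fun j k z => z j * z k - if j = k then 1 else 0 with hφ
  have hφm : ∀ j k, MemLp (φ j k) 2 Q := fun j k => (hmem j k).sub (memLp_const _)
  have hφ0 : ∀ j k, ∫ z, φ j k z ∂Q = 0 := fun j k => by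
    rw [hφ, integral_sub ((hmem j k).integrable one_le_two) (integrable_const _), hQ]
    simp
  have hvar : ∀ j k, ProbabilityTheory.variance (φ j k) Q ≤ ∫ z, (z j * z k) ^ 2 ∂Q := fun j k => by
    rw [hφ, ProbabilityTheory.variance_sub_const (hmem j k).aestronglyMeasurable]
    exact ProbabilityTheory.variance_le_expectation_sq (hmem j k).aestronglyMeasurable
  set μ := Measure.pi fun _ : Fin n => Q with hμ
  have hcomp : ∀ j k (i : Fin n), MemLp (fun z : Fin n → EucSp m => φ j k (z i)) 2 μ :=
    fun j k i => (hφm j k).comp_measurePreserving (measurePreserving_eval _ i)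
  have hsumL : ∀ j k, MemLp (fun z : Fin n → EucSp m => ∑ i, φ j k (z i)) 2 μ := fun j k =>
    memLp_finsetSum _ fun i _ => hcomp j k i
  have hE : ∀ j k, ∫ z, (∑ i, φ j k (z i)) ^ 2 ∂μ = n * ProbabilityTheory.variance (φ j k) Q := by
    intro j k
    have h := ProbabilityTheory.variance_sum_pi (μ := fun _ : Fin n => Q)
      (X := fun _ => φ j k) fun _ => hφm j k
    rw [Finset.sum_const, Finset.card_univ, Fintype.card_fin, nsmul_eq_mul] at h
    rw [← h, ProbabilityTheory.variance_of_integral_eq_zero]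
    · simp [hμ]
    · have := (hsumL j k).aestronglyMeasurable.aemeasurable
      convert this using 1
      ext z; simp
    · have : (∫ z, (∑ i, fun ω : Fin n → EucSp m => φ j k (ω i)) z ∂μ) =
          ∫ z, ∑ i, φ j k (z i) ∂μ := by simp
      rw [this, integral_finsetSum _ fun i _ => (hcomp j k i).integrable one_le_two]
      refine Finset.sum_eq_zero fun i _ => ?_
      rw [← hφ0 j k]
      exact integral_comp_eval (hφm j k).aestronglyMeasurable
  have hnorm : ∀ z : EucSp m, ∑ j, ∑ k, (z j * z k) ^ 2 = (‖z‖ ^ 2) ^ 2 := fun z => by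
    rw [EuclideanSpace.real_norm_sq_eq, sq (∑ j, _), Finset.sum_mul_sum]
    simp_rw [mul_pow]
  have hfour : ∑ j, ∑ k, ∫ z : EucSp m, (z j * z k) ^ 2 ∂Q ≤ L ^ 2 * m := by
    have hint : Integrable (fun z : EucSp m => ∑ j, z j * z j) Q :=
      integrable_finsetSum _ fun j _ => (hmem j j).integrable one_le_two
    calc ∑ j, ∑ k, ∫ z : EucSp m, (z j * z k) ^ 2 ∂Q = ∫ z, (‖z‖ ^ 2) ^ 2 ∂Q := by
          simp_rw [← hnorm]
          rw [integral_finsetSum _ fun j _ => integrable_finsetSum _ fun k _ => hint2 j k]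
          refine Finset.sum_congr rfl fun j _ => ?_
          rw [integral_finsetSum _ fun k _ => hint2 j k]
      _ ≤ ∫ z : EucSp m, L ^ 2 * ∑ j, z j * z j ∂Q := by
          refine integral_mono_ae ?_ (hint.const_mul _) ?_
          · simp_rw [← hnorm]
            exact integrable_finsetSum _ fun j _ => integrable_finsetSum _ fun k _ => hint2 j k
          · filter_upwards [hQL] with z hz
            have : ∑ j, z j * z j = ‖z‖ ^ 2 := by
              rw [EuclideanSpace.real_norm_sq_eq]; simp_rw [sq]
            rw [this, sq (‖z‖ ^ 2)]
            gcongr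
      _ = L ^ 2 * m := by
          rw [integral_const_mul, integral_finsetSum _ fun j _ => (hmem j j).integrable one_le_two]
          simp [hQ]
  have hFi : Integrable (fun z : Fin n → EucSp m => frobeniusDeviation z) μ :=
    integrable_finsetSum _ fun j _ => integrable_finsetSum _ fun k _ => (hsumL j k).integrable_sq
  have hF0 : ∀ z : Fin n → EucSp m, 0 ≤ frobeniusDeviation z := fun z =>
    Finset.sum_nonneg fun j _ => Finset.sum_nonneg fun k _ => sq_nonneg _
  have hEF : ∫ z, frobeniusDeviation z ∂μ ≤ n * (L ^ 2 * m) := by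
    calc ∫ z, frobeniusDeviation z ∂μ = ∑ j, ∑ k, ∫ z, (∑ i, φ j k (z i)) ^ 2 ∂μ := by
          unfold frobeniusDeviation
          rw [integral_finsetSum _ fun j _ => integrable_finsetSum _ fun k _ =>
            (hsumL j k).integrable_sq]
          refine Finset.sum_congr rfl fun j _ => ?_
          rw [integral_finsetSum _ fun k _ => (hsumL j k).integrable_sq]
      _ ≤ ∑ j, ∑ k, n * ∫ z : EucSp m, (z j * z k) ^ 2 ∂Q := by
          gcongr with j _ k _
          rw [hE]
          gcongr
          exact hvar j k
      _ ≤ _ := by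
          simp_rw [← Finset.mul_sum]
          gcongr
  have hM := mul_meas_ge_le_integral_of_nonneg (μ := μ)
    (Filter.Eventually.of_forall hF0) hFi ((n : ℝ) ^ 2 / 4)
  rw [measureReal_def] at hM
  rw [← ENNReal.ofReal_toReal (measure_ne_top μ _)]
  refine ENNReal.ofReal_le_ofReal ?_
  rw [le_div_iff₀ hn']
  have h5 := hM.trans hEF
  refine le_of_mul_le_mul_left ?_ (show (0 : ℝ) < n / 4 by positivity)
  calc _ = (n : ℝ) ^ 2 / 4 * (μ {z | (n : ℝ) ^ 2 / 4 ≤ frobeniusDeviation z}).toReal := by ring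
    _ ≤ n * (L ^ 2 * m) := h5
    _ = _ := by ring

theorem abs_modOne_le (y : ℝ) : |modOne y| ≤ 1 / 2 := by
  have h := toIocMod_mem_Ioc one_pos (-(1 / 2) : ℝ) y
  rw [modOne, abs_le]
  constructor <;> linarith [h.1, h.2]

theorem modOne_eq_sub (y : ℝ) : ∃ k : ℤ, modOne y = y - k := by
  refine ⟨toIocDiv one_pos (-(1 / 2) : ℝ) y, ?_⟩
  have := toIocMod_add_toIocDiv_zsmul one_pos (-(1 / 2) : ℝ) y
  rw [modOne]
  simp at this
  linarith

theorem measurable_modOne : Measurable modOne := by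
  have : modOne = fun y => y - (toIocDiv one_pos (-(1 / 2) : ℝ) y : ℝ) := by
    ext y
    have := toIocMod_add_toIocDiv_zsmul one_pos (-(1 / 2) : ℝ) y
    rw [modOne]
    simp at this
    linarith
  rw [this]
  simp_rw [toIocDiv_eq_neg_floor]
  fun_prop

theorem abs_cos_le_one_sub_modOne (y : ℝ) : |cos (π * y)| ≤ 1 - 2 * |modOne y| ^ 2 := by
  obtain ⟨k, hk⟩ := modOne_eq_sub y
  have h1 : |cos (π * y)| = |cos (π * modOne y)| := by
    rw [hk, mul_sub, mul_comm π (k : ℝ), cos_sub_int_mul_pi, abs_mul, abs_zpow]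
    simp
  have h2 : |π * modOne y| ≤ π / 2 := by
    rw [abs_mul, abs_of_pos pi_pos]
    nlinarith [abs_modOne_le y, pi_pos]
  have h3 : 0 ≤ cos (π * modOne y) := cos_nonneg_of_mem_Icc (abs_le.1 h2)
  rw [h1, abs_of_nonneg h3]
  refine (cos_le_one_sub_mul_cos_sq (h2.trans (by linarith [pi_pos]))).trans (le_of_eq ?_)
  rw [sq_abs]; field_simp

theorem integral_abs_cos_le {m : ℕ} (Q : Measure (EucSp m)) [IsProbabilityMeasure Q]
    (θ : EucSp m) : ∫ z, |cos (π * inner ℝ θ z)| ∂Q ≤ exp (-2 * tildeFn Q θ ^ 2) := by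
  have hm : Measurable fun z : EucSp m => |modOne (inner ℝ θ z)| ^ 2 :=
    ((measurable_modOne.comp (by fun_prop)).abs).pow_const 2
  have hi : Integrable (fun z => |modOne (inner ℝ θ z)| ^ 2) Q := by
    refine Integrable.mono' (integrable_const (1 : ℝ)) hm.aestronglyMeasurable
      (Filter.Eventually.of_forall fun z => ?_)
    have := abs_modOne_le (inner ℝ θ z)
    rw [norm_eq_abs, abs_of_nonneg (by positivity)]
    exact pow_le_one₀ (abs_nonneg _) (by linarith)
  have ht : tildeFn Q θ ^ 2 = ∫ z, |modOne (inner ℝ θ z)| ^ 2 ∂Q :=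
    sq_sqrt (integral_nonneg fun z => by positivity)
  calc ∫ z, |cos (π * inner ℝ θ z)| ∂Q ≤ ∫ z, (1 - 2 * |modOne (inner ℝ θ z)| ^ 2) ∂Q := by
        refine integral_mono ?_ ((integrable_const _).sub (hi.const_mul 2)) fun z =>
          abs_cos_le_one_sub_modOne _
        refine Integrable.mono' (integrable_const (1 : ℝ))
          (by fun_prop : Continuous _).aestronglyMeasurable
          (Filter.Eventually.of_forall fun z => ?_)
        simpa using abs_cos_le_one _
    _ = 1 - 2 * tildeFn Q θ ^ 2 := by
        rw [integral_sub (integrable_const _) (hi.const_mul 2), integral_const_mul, ht]; simp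
    _ ≤ _ := by
        have := add_one_le_exp (-2 * tildeFn Q θ ^ 2)
        linarith

/-- Markov's inequality for the integral over `R` of the product of cosines; by independence its
expectation is an integral of `n`-th powers. -/
theorem measure_lintegral_prod_cos_ge {m n : ℕ} (Q : Measure (EucSp m)) [IsProbabilityMeasure Q]
    {R : Set (EucSp m)} {τ : ℝ} (hτ : ∀ θ ∈ R, τ ≤ tildeFn Q θ ^ 2)
    {κ : ℝ≥0∞} (hκ : κ ≠ 0) (hκ' : κ ≠ ∞) :
    (Measure.pi fun _ : Fin n => Q)
        {z | κ ≤ ∫⁻ θ in R, ENNReal.ofReal (∏ i, |cos (π * inner ℝ θ (z i))|)} ≤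
      ENNReal.ofReal (exp (-2 * n * τ)) * volume R / κ := by
  have hcont : Continuous fun p : (Fin n → EucSp m) × EucSp m =>
      ENNReal.ofReal (∏ i, |cos (π * inner ℝ p.2 (p.1 i))|) := by
    refine ENNReal.continuous_ofReal.comp ?_
    fun_prop
  have hmeas : Measurable fun z : Fin n → EucSp m =>
      ∫⁻ θ in R, ENNReal.ofReal (∏ i, |cos (π * inner ℝ θ (z i))|) :=
    Measurable.lintegral_prod_right' (f := fun p : (Fin n → EucSp m) × EucSp m =>
      ENNReal.ofReal (∏ i, |cos (π * inner ℝ p.2 (p.1 i))|)) hcont.measurable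
  refine (meas_ge_le_lintegral_div hmeas.aemeasurable hκ hκ').trans ?_
  gcongr
  rw [lintegral_lintegral_swap hcont.measurable.aemeasurable]
  calc _ ≤ ∫⁻ _ in R, ENNReal.ofReal (exp (-2 * n * τ)) := by
        refine setLIntegral_mono measurable_const fun θ hθ => ?_
        have hint : Integrable (fun z : Fin n → EucSp m => ∏ i, |cos (π * inner ℝ θ (z i))|)
            (Measure.pi fun _ : Fin n => Q) := by
          refine Integrable.mono' (integrable_const (1 : ℝ))
            (by fun_prop : Continuous _).aestronglyMeasurable
            (Filter.Eventually.of_forall fun z => ?_)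
          rw [norm_eq_abs, Finset.abs_prod]
          exact Finset.prod_le_one (fun _ _ => abs_nonneg _) fun i _ => by
            simpa using abs_cos_le_one _
        rw [← ofReal_integral_eq_lintegral_ofReal hint
          (Filter.Eventually.of_forall fun z => Finset.prod_nonneg fun _ _ => abs_nonneg _),
          integral_fintype_prod_eq_pow (fun z => |cos (π * inner ℝ θ z)|), Fintype.card_fin]
        refine ENNReal.ofReal_le_ofReal ?_
        calc _ ≤ exp (-2 * tildeFn Q θ ^ 2) ^ n :=
              pow_le_pow_left₀ (integral_nonneg fun z => abs_nonneg _) (integral_abs_cos_le Q θ) n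
          _ = exp (n * (-2 * tildeFn Q θ ^ 2)) := (exp_nat_mul _ _).symm
          _ ≤ _ := by
              refine exp_le_exp.2 ?_
              have := mul_le_mul_of_nonneg_left (hτ θ hθ) (Nat.cast_nonneg (α := ℝ) n)
              linarith
    _ = _ := by rw [setLIntegral_const]

end

/-! ### Signed sums of isotropic lattice vectors -/

section

/-- A positive definite Gram form is the square of a norm in suitable linear coordinates. -/
theorem exists_linearEquiv_norm_sq {E : Type*} [NormedAddCommGroup E] [InnerProductSpace ℝ E]
    [FiniteDimensional ℝ E] {n : ℕ} (z : Fin n → E)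
    (hz : ∀ θ, ∑ i, inner ℝ θ (z i) ^ 2 = 0 → θ = 0) :
    ∃ B : E ≃ₗ[ℝ] E, ∀ θ, ‖B θ‖ ^ 2 = ∑ i, inner ℝ θ (z i) ^ 2 := by
  let T : E →ₗ[ℝ] EuclideanSpace ℝ (Fin n) :=
    { toFun := fun θ => WithLp.toLp 2 fun i => inner ℝ θ (z i)
      map_add' := fun x y => by ext i; simp [inner_add_left]
      map_smul' := fun c x => by ext i; simp [real_inner_smul_left] }
  have hT : ∀ θ, ‖T θ‖ ^ 2 = ∑ i, inner ℝ θ (z i) ^ 2 := fun θ => by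
    rw [EuclideanSpace.real_norm_sq_eq]; rfl
  have hinj : Function.Injective T := by
    rw [← LinearMap.ker_eq_bot, LinearMap.ker_eq_bot']
    intro θ h0
    apply hz
    rw [← hT, h0]; simp
  have hfin : finrank ℝ (LinearMap.range T) = finrank ℝ E := LinearMap.finrank_range_of_inj hinj
  let J : LinearMap.range T ≃ₗᵢ[ℝ] E :=
    (stdOrthonormalBasis ℝ (LinearMap.range T)).equiv (stdOrthonormalBasis ℝ E) (finCongr hfin)
  refine ⟨(LinearEquiv.ofInjective T hinj).trans J.toLinearEquiv, fun θ => ?_⟩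
  rw [← hT]
  simp

theorem integrable_coord_mul {m : ℕ} {P : Measure (EucSp m)} [IsProbabilityMeasure P] {K : ℝ}
    (hK : ∀ᵐ x ∂P, ‖x‖ ≤ K) (j k : Fin m) :
    Integrable (fun x : EucSp m => x j * x k) P := by
  refine Integrable.of_bound (by fun_prop) (K * K) ?_
  filter_upwards [hK] with z hz
  have hj : ∀ j, |z j| ≤ K := fun j =>
    (by simpa using PiLp.norm_apply_le z j : |z j| ≤ ‖z‖).trans hz
  rw [norm_eq_abs, abs_mul]
  have := (abs_nonneg _).trans (hj j)
  gcongr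
  exacts [hj j, hj k]

theorem integral_inner_mul_inner {m : ℕ} {P : Measure (EucSp m)} [IsProbabilityMeasure P] {K : ℝ}
    (hK : ∀ᵐ x ∂P, ‖x‖ ≤ K) (a b : EucSp m) :
    ∫ x, inner ℝ a x * inner ℝ b x ∂P = ∑ j, ∑ k, a j * secondMoment P j k * b k := by
  have h : ∀ x : EucSp m, inner ℝ a x * inner ℝ b x =
      ∑ j, ∑ k, (a j * b k) * (x j * x k) := fun x => by
    rw [PiLp.inner_apply, PiLp.inner_apply, Finset.sum_mul_sum]
    refine Finset.sum_congr rfl fun j _ => Finset.sum_congr rfl fun k _ => ?_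
    simp; ring
  simp_rw [h]
  have hi := integrable_coord_mul hK
  rw [integral_finsetSum _ fun j _ => integrable_finsetSum _ fun k _ => (hi j k).const_mul _]
  refine Finset.sum_congr rfl fun j _ => ?_
  rw [integral_finsetSum _ fun k _ => (hi j k).const_mul _]
  refine Finset.sum_congr rfl fun k _ => ?_
  rw [integral_const_mul, secondMoment, Matrix.of_apply]; ring

theorem integral_inner_sq {m : ℕ} (Q : Measure (EucSp m)) [IsProbabilityMeasure Q] {L : ℝ}
    (hQL : ∀ᵐ z ∂Q, ‖z‖ ≤ L)
    (hQ : ∀ j k : Fin m, ∫ z, z j * z k ∂Q = if j = k then 1 else 0) (θ : EucSp m) :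
    ∫ z, inner ℝ θ z ^ 2 ∂Q = ‖θ‖ ^ 2 := by
  simp_rw [sq (inner ℝ θ _)]
  rw [integral_inner_mul_inner hQL, EuclideanSpace.real_norm_sq_eq]
  simp [secondMoment, hQ, sq]

/-- A dual vector shorter than `1 / L` has integral inner products smaller than `1` with the random
vector, so these vanish almost surely, which isotropy excludes. -/
theorem inv_le_norm_of_dual {m : ℕ} (Q : Measure (EucSp m)) [IsProbabilityMeasure Q] {L : ℝ}
    (hL : 0 < L) {Λ : Submodule ℤ (EucSp m)} (hQL : ∀ᵐ z ∂Q, z ∈ Λ ∧ ‖z‖ ≤ L)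
    (hQ : ∀ j k : Fin m, ∫ z, z j * z k ∂Q = if j = k then 1 else 0) {μ : EucSp m}
    (hμ : μ ∈ dualLattice Λ) (hμ0 : μ ≠ 0) : 1 / L ≤ ‖μ‖ := by
  by_contra! hlt
  apply hμ0
  have h0 : ∫ z, inner ℝ μ z ^ 2 ∂Q = 0 := by
    rw [integral_eq_zero_of_ae]
    filter_upwards [hQL] with z hz
    obtain ⟨k, hk⟩ := hμ z hz.1
    have h1 : |inner ℝ μ z| < 1 := by
      calc |inner ℝ μ z| ≤ ‖μ‖ * ‖z‖ := abs_real_inner_le_norm _ _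
        _ ≤ ‖μ‖ * L := by gcongr; exact hz.2
        _ < 1 / L * L := by gcongr
        _ = 1 := by field_simp
    rw [hk] at h1 ⊢
    have : |k| < 1 := by exact_mod_cast h1
    rw [Int.abs_lt_one_iff.1 this]; simp
  rw [integral_inner_sq Q (hQL.mono fun z hz => hz.2) hQ] at h0
  simpa using h0

/-- The numerical estimate behind the tail bound, with `q = √n` and `D` the covolume: each of the
logarithms of `n^{m/2}` and of `D` is at most a small multiple of `q / L`. -/
theorem exp_mul_rpow_le {m q L D : ℝ} (hm : 1 ≤ m) (hL : 1 ≤ L) (hD : 0 < D) (hq : 0 < q)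
    (h1 : 1000 * m * L * (1 + log m + log L) ≤ q) (h3 : 1000 * L * |log D| ≤ q) :
    exp (-(1000 / 32) * (q / L)) * D⁻¹ / (1 / 4 * (1 / (π * q ^ 2)) ^ (m / 2)) ≤ 4 * (L / q) := by
  have hL0 : 0 < L := by linarith
  have hm0 : 0 < m := by linarith
  set x := q / L with hx
  have hx0 : 0 < x := by positivity
  have hlm : 0 ≤ log m := log_nonneg hm
  have hlL : 0 ≤ log L := log_nonneg hL
  have e1 : m * (1 + log m + log L) ≤ x := by
    rw [hx, le_div_iff₀ hL0]
    have : 0 ≤ m * L * (1 + log m + log L) := by positivity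
    linarith
  have e3 : |log D| ≤ x := by
    rw [hx, le_div_iff₀ hL0]
    have : 0 ≤ L * |log D| := by positivity
    linarith
  have elq : m * log q ≤ m * (log m + log L) + x := by
    have hq' : q = m * L * (q / (m * L)) := by field_simp
    have : log q ≤ log m + log L + q / (m * L) := by
      conv_lhs => rw [hq', log_mul (by positivity) (by positivity), log_mul hm0.ne' hL0.ne']
      have := log_le_sub_one_of_pos (show 0 < q / (m * L) by positivity)
      linarith
    calc m * log q ≤ m * (log m + log L + q / (m * L)) := by gcongr
      _ = _ := by rw [hx]; field_simp
  have elpi : log π ≤ 3 := by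
    have := log_le_sub_one_of_pos pi_pos
    linarith [pi_le_four]
  have hpow : (1 / (π * q ^ 2)) ^ (m / 2) = exp (-(m / 2 * log π + m * log q)) := by
    rw [rpow_def_of_pos (by positivity), one_div, log_inv, log_mul (by positivity) (by positivity),
      log_pow]
    congr 1; push_cast; ring
  have hDe : D⁻¹ = exp (-log D) := by rw [exp_neg, exp_log hD]
  rw [hpow, hDe, ← exp_add]
  have hfin : exp (-x) ≤ L / q := by
    have h6 := add_one_le_exp x
    rw [exp_neg, show L / q = x⁻¹ by rw [hx, inv_div]]
    exact inv_anti₀ hx0 (by linarith)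
  calc exp (-(1000 / 32) * x + -log D) / (1 / 4 * exp (-(m / 2 * log π + m * log q)))
      = 4 * exp (-(1000 / 32) * x + -log D + (m / 2 * log π + m * log q)) := by
        rw [exp_neg (m / 2 * log π + m * log q), exp_add _ (m / 2 * log π + m * log q)]
        field_simp
    _ ≤ 4 * exp (-x) := by
        gcongr
        have := neg_abs_le (log D)
        have : m * log π ≤ m * 3 := by gcongr
        have : 0 ≤ m * (log m + log L) := by positivity
        linarith
    _ ≤ _ := by gcongr

/-- With probability `1 - O(L / √n)`, all vectors of norm at most `√(n / 10)` in the coset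
`∑ zᵢ + 2 Λ` are signed sums of the `zᵢ`. The hypotheses `h1`, `h2`, `h3` correspond to the three terms
of `N₀`. -/
theorem exists_signs_whitened {m n : ℕ} (hm : 1 ≤ m) (hn : 0 < n) (Q : Measure (EucSp m))
    [IsProbabilityMeasure Q] (e : Basis (Fin m) ℝ (EucSp m)) {L : ℝ} (hL : 1 ≤ L)
    (hQL : ∀ᵐ z ∂Q, z ∈ Submodule.span ℤ (Set.range e) ∧ ‖z‖ ≤ L)
    (hQ : ∀ j k : Fin m, ∫ z, z j * z k ∂Q = if j = k then 1 else 0)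
    (h1 : 1000 * m * L * (1 + log m + log L) ≤ √n)
    (h2 : ∀ θ ∉ dualLattice (Submodule.span ℤ (Set.range e)),
      IsPseudodual Q (Submodule.span ℤ (Set.range e)) θ → 1000 / (L * √n) ≤ tildeFn Q θ ^ 2)
    (h3 : 1000 * L * |log ((volume : Measure (EucSp m)).real (ZSpan.fundamentalDomain e))| ≤ √n) :
    ∃ bad : Set (Fin n → EucSp m),
      (Measure.pi fun _ : Fin n => Q) bad ≤ ENNReal.ofReal (5 * (L / √n)) ∧
      ∀ z ∉ bad, ∀ u ∈ Submodule.span ℤ (Set.range e), ‖∑ i, z i - (2 : ℝ) • u‖ ^ 2 ≤ n / 10 →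
        ∃ y : Fin n → ℤˣ, ∑ i, ((y i : ℤ) : ℝ) • z i = ∑ i, z i - (2 : ℝ) • u := by
  set Λ := Submodule.span ℤ (Set.range e) with hΛ
  have hn' : (0 : ℝ) < n := by exact_mod_cast hn
  have hm' : (1 : ℝ) ≤ m := by exact_mod_cast hm
  have hL0 : 0 < L := by linarith
  set q := √(n : ℝ) with hq
  have hq0 : 0 < q := sqrt_pos.2 hn'
  have hqn : q ^ 2 = n := sq_sqrt hn'.le
  have hlm : 0 ≤ log m := log_nonneg hm'
  have hlL : 0 ≤ log L := log_nonneg hL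
  have hmLq : 1000 * m * L ≤ q := by
    have : 0 ≤ 1000 * m * L * (log m + log L) := by positivity
    linarith
  have hQL' : ∀ᵐ z ∂Q, ‖z‖ ≤ L := hQL.mono fun z hz => hz.2
  obtain ⟨f, hf⟩ := exists_inner_dual_basis e
  have hdual : ∀ θ, θ ∈ Submodule.span ℤ (Set.range f) ↔ θ ∈ dualLattice Λ := fun θ =>
    mem_span_dual_iff hf θ
  have hdual' : (Submodule.span ℤ (Set.range f) : Set (EucSp m)) = dualLattice Λ := by
    ext θ; exact hdual θ
  set r : ℝ := 1 / (4 * L) with hr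
  have hr0 : 0 < r := by positivity
  obtain ⟨S, hS, hSm, hbS, hSR⟩ := exists_fundamentalDomain_ball f (r := r) fun μ hμ hμ0 => by
    have := inv_le_norm_of_dual Q hL0 hQL hQ ((hdual μ).1 hμ) hμ0
    have h7 : 2 * r ≤ 1 / L := by rw [hr]; field_simp; norm_num
    linarith
  rw [hdual'] at hSR
  set R : Set (EucSp m) := {θ ∈ ZSpan.fundamentalDomain f | r ≤ Metric.infDist θ (dualLattice Λ)}
    with hR
  set D := (volume : Measure (EucSp m)).real (ZSpan.fundamentalDomain e) with hD
  have hDf := volume_fundamentalDomain_dual (EuclideanSpace.basisFun (Fin m) ℝ) hf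
  rw [← hD] at hDf
  have hD0 : 0 < D := measureReal_nonneg.lt_of_ne fun h => by simp [hD, ← h] at hDf
  have hfin : volume (ZSpan.fundamentalDomain f) ≠ ∞ :=
    (ZSpan.fundamentalDomain_isBounded f).measure_lt_top.ne
  have hvolf : volume (ZSpan.fundamentalDomain f) = ENNReal.ofReal D⁻¹ := by
    rw [← ENNReal.ofReal_toReal hfin, ← measureReal_def, eq_inv_of_mul_eq_one_left hDf]
  have hSf : volume S ≠ ∞ := by
    have : VAddInvariantMeasure (Submodule.span ℤ (Set.range f)) (EucSp m) volume :=
      inferInstanceAs (VAddInvariantMeasure (Submodule.span ℤ (Set.range f)).toAddSubgroup _ _)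
    rwa [hS.measure_eq (ZSpan.isAddFundamentalDomain f volume)]
  -- away from the dual lattice the characteristic function is small
  set τ : ℝ := 1000 / (64 * (L * q)) with hτ
  have hτR : ∀ θ ∈ R, τ ≤ tildeFn Q θ ^ 2 := by
    intro θ hθ
    by_cases hps : IsPseudodual Q Λ θ
    · have hnd : θ ∉ dualLattice Λ := fun hmem => by
        have := hθ.2
        rw [Metric.infDist_zero_of_mem hmem] at this
        linarith
      refine le_trans ?_ (h2 θ hnd hps)
      rw [hτ]
      have := mul_pos hL0 hq0
      exact div_le_div_of_nonneg_left (by norm_num) this (by linarith)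
    · have h8 : 1 / (8 * L) ≤ tildeFn Q θ := by
        rw [IsPseudodual, not_le] at hps
        have := hθ.2
        have h9 : r / 2 = 1 / (8 * L) := by rw [hr]; field_simp; norm_num
        linarith
      calc τ ≤ (1 / (8 * L)) ^ 2 := by
            rw [hτ, div_pow, div_le_div_iff₀ (by positivity) (by positivity)]
            have : L * (1000 * L) ≤ L * q := by
              gcongr
              nlinarith
            nlinarith
        _ ≤ _ := by gcongr
  set g : ℝ := (1 / (π * n)) ^ (m / 2 : ℝ) with hg
  have hg0 : 0 < g := by positivity
  set κ := ENNReal.ofReal (1 / 4 * g) with hκ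
  have hP1 := measure_frobeniusDeviation_ge hn Q hL0.le hQL' hQ
  have hP2 := measure_lintegral_prod_cos_ge (n := n) Q hτR (κ := κ)
    (by rw [hκ, Ne, ENNReal.ofReal_eq_zero, not_le]; positivity) ENNReal.ofReal_ne_top
  have hae : ∀ᵐ z ∂(Measure.pi fun _ : Fin n => Q), ∀ i, z i ∈ Λ ∧ ‖z i‖ ≤ L := by
    rw [ae_all_iff]
    intro i
    exact (measurePreserving_eval (fun _ : Fin n => Q) i).quasiMeasurePreserving.ae hQL
  refine ⟨{z | (n : ℝ) ^ 2 / 4 ≤ frobeniusDeviation z} ∪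
    {z | κ ≤ ∫⁻ θ in R, ENNReal.ofReal (∏ i, |cos (π * inner ℝ θ (z i))|)} ∪
    {z | ¬ ∀ i, z i ∈ Λ ∧ ‖z i‖ ≤ L}, ?_, ?_⟩
  · have hb1 : 4 * L ^ 2 * m / n ≤ L / q := by
      rw [← hqn, div_le_div_iff₀ (by positivity) hq0]
      have := mul_le_mul_of_nonneg_left hmLq (show 0 ≤ L * q by positivity)
      have : 0 ≤ L * q * (m * L) := by positivity
      nlinarith
    have hb2 : exp (-2 * n * τ) * D⁻¹ / (1 / 4 * g) ≤ 4 * (L / q) := by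
      have h := exp_mul_rpow_le hm' hL hD0 hq0 h1 h3
      rw [hqn, ← hg] at h
      convert h using 4
      rw [hτ, ← hqn]; field_simp; norm_num
    refine (measure_union_le _ _).trans ?_
    rw [show (Measure.pi fun _ : Fin n => Q) {z | ¬ ∀ i, z i ∈ Λ ∧ ‖z i‖ ≤ L} = 0 from hae,
      add_zero]
    refine (measure_union_le _ _).trans ?_
    rw [show 5 * (L / q) = L / q + 4 * (L / q) by ring,
      ENNReal.ofReal_add (by positivity) (by positivity)]
    refine add_le_add (hP1.trans (ENNReal.ofReal_le_ofReal hb1)) (hP2.trans ?_)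
    refine le_trans ?_ (ENNReal.ofReal_le_ofReal hb2)
    rw [ENNReal.ofReal_div_of_pos (by positivity), ENNReal.ofReal_mul (exp_pos _).le, ← hvolf]
    gcongr
    exact Set.sep_subset _ _
  · intro z hz u hu hzu
    simp only [Set.mem_union, Set.mem_ofPred_eq, not_or, not_le, not_not] at hz
    obtain ⟨⟨hz1, hz2⟩, hz3⟩ := hz
    have hA := abs_sum_inner_sq_sub_le z hz1
    have hAlow : ∀ θ, (n / 2 : ℝ) * ‖θ‖ ^ 2 ≤ ∑ i, inner ℝ θ (z i) ^ 2 := fun θ => by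
      have := (abs_le.1 (hA θ)).1
      linarith
    have hAup : ∀ θ, ∑ i, inner ℝ θ (z i) ^ 2 ≤ 2 * n * ‖θ‖ ^ 2 := fun θ => by
      have := (abs_le.1 (hA θ)).2
      have : 0 ≤ n * ‖θ‖ ^ 2 := by positivity
      linarith
    obtain ⟨B, hB⟩ := exists_linearEquiv_norm_sq z fun θ h0 => by
      have := hAlow θ
      rw [h0] at this
      have h10 : ‖θ‖ ^ 2 ≤ 0 := by
        by_contra! hpos
        have : 0 < (n / 2 : ℝ) * ‖θ‖ ^ 2 := by positivity
        linarith
      simpa using le_antisymm h10 (sq_nonneg _)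
    refine exists_signs_of_integral_ne_zero hS hSf (fun μ hμ w hw => (hdual μ).1 hμ w hw) z
      (fun i => (hz3 i).1) hu rfl ?_
    set v := ∑ i, z i - (2 : ℝ) • u with hv
    have hmain := local_lower_bound (E := EucSp m) (by simpa using hm) hn z B hB
      (fun θ => by rw [hB]; exact hAlow θ) (fun θ => by rw [hB]; exact hAup θ) hL0
      (fun i => (hz3 i).2)
      (by
        rw [finrank_euclideanSpace_fin, ← hqn]
        have : (1000 * m * L) ^ 2 ≤ q ^ 2 := by gcongr
        have : 0 ≤ (m * L) ^ 2 := by positivity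
        nlinarith) hzu
    rw [finrank_euclideanSpace_fin, ← hr, ← hg] at hmain
    set F : EucSp m → ℝ := fun θ => (∏ i, cos (π * inner ℝ θ (z i))) * cos (π * inner ℝ θ v)
      with hF
    have hFb : ∀ θ, |F θ| ≤ ∏ i, |cos (π * inner ℝ θ (z i))| := fun θ => by
      rw [hF, abs_mul, Finset.abs_prod]
      exact mul_le_of_le_one_right (Finset.prod_nonneg fun _ _ => abs_nonneg _) (abs_cos_le_one _)
    have hFi : IntegrableOn F S := by
      have : Fact (volume S < ∞) := ⟨hSf.lt_top⟩
      refine Integrable.mono' (integrable_const (1 : ℝ))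
        (by fun_prop : Continuous F).aestronglyMeasurable
        (Filter.Eventually.of_forall fun θ => ?_)
      exact (hFb θ).trans (Finset.prod_le_one (fun _ _ => abs_nonneg _) fun i _ => abs_cos_le_one _)
    have htail : |∫ θ in S \ Metric.ball 0 r, F θ| ≤ 1 / 4 * g := by
      rw [← norm_eq_abs, ← ENNReal.ofReal_le_ofReal_iff (by positivity), ofReal_norm]
      refine (enorm_integral_le_lintegral_enorm _).trans (le_trans ?_ hz2.le)
      refine (lintegral_mono_set hSR).trans (lintegral_mono fun θ => ?_)
      rw [← ofReal_norm, norm_eq_abs]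
      exact ENNReal.ofReal_le_ofReal (hFb θ)
    have hsplit : ∫ θ in S, F θ =
        (∫ θ in Metric.ball 0 r, F θ) + ∫ θ in S \ Metric.ball 0 r, F θ := by
      rw [← setIntegral_union Set.disjoint_sdiff_right (hSm.diff Metric.isOpen_ball.measurableSet)
        (hFi.mono_set hbS) (hFi.mono_set Set.sdiff_subset), Set.union_sdiff_cancel hbS]
    have := (abs_le.1 htail).1
    rw [hsplit]
    apply ne_of_gt
    linarith

end

/-! ### Whitening -/

section

variable {m : ℕ} {P : Measure (EucSp m)} {L : ℝ}

theorem exists_ae_norm_le (hL : P.support ⊆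
    Matrix.toEuclideanLin (sqrtSecondMoment P) '' Metric.closedBall 0 L) :
    ∃ K : ℝ, ∀ᵐ x ∂P, ‖x‖ ≤ K := by
  have hcomp : IsCompact (Matrix.toEuclideanLin (sqrtSecondMoment P) ''
      Metric.closedBall (0 : EucSp m) L) :=
    (isCompact_closedBall _ _).image (LinearMap.continuous_of_finiteDimensional _)
  obtain ⟨K, hK⟩ := hcomp.isBounded.exists_norm_le
  refine ⟨K, ?_⟩
  filter_upwards [P.support_mem_ae] with x hx
  exact hK x (hL hx)

variable [IsProbabilityMeasure P]

theorem inner_secondMoment {K : ℝ} (hK : ∀ᵐ x ∂P, ‖x‖ ≤ K) (a b : EucSp m) :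
    inner ℝ a (Matrix.toEuclideanLin (secondMoment P) b) =
      ∫ x, inner ℝ a x * inner ℝ b x ∂P := by
  rw [integral_inner_mul_inner hK, PiLp.inner_apply]
  refine Finset.sum_congr rfl fun j _ => ?_
  simp only [Matrix.ofLp_toLpLin, Matrix.toLin'_apply, Matrix.mulVec, dotProduct, RCLike.inner_apply,
    conj_trivial, Finset.sum_mul]
  exact Finset.sum_congr rfl fun k _ => by ring

/-- If the quadratic form of `Σ` vanished at `a`, the support, hence the lattice it spans, would be
orthogonal to `a`. -/
theorem secondMoment_posDef {Λ : Submodule ℤ (EucSp m)} [DiscreteTopology Λ] [IsZLattice ℝ Λ]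
    (hΛ : Λ = Submodule.span ℤ P.support) {K : ℝ} (hK : ∀ᵐ x ∂P, ‖x‖ ≤ K) :
    (secondMoment P).PosDef := by
  have hherm : (secondMoment P).IsHermitian := by
    ext j k
    simp [secondMoment, mul_comm]
  refine Matrix.PosDef.of_dotProduct_mulVec_pos hherm fun v hv => ?_
  set a : EucSp m := WithLp.toLp 2 v with ha
  have hq := inner_secondMoment hK a a
  have h1 : star v ⬝ᵥ (secondMoment P *ᵥ v) = ∫ x, inner ℝ a x ^ 2 ∂P := by
    simp_rw [sq]
    rw [← hq, PiLp.inner_apply]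
    simp [dotProduct, ha, mul_comm]
  rw [h1]
  refine (integral_nonneg fun x => sq_nonneg _).lt_of_ne fun h0 => hv ?_
  have hint : Integrable (fun x => inner ℝ a x ^ 2) P := by
    refine Integrable.of_bound (by fun_prop) ((‖a‖ * K) ^ 2) ?_
    filter_upwards [hK] with x hx
    rw [norm_pow, norm_eq_abs]
    gcongr
    exact (abs_real_inner_le_norm _ _).trans (by gcongr)
  have hae : ∀ᵐ x ∂P, inner ℝ a x = 0 := by
    have := (integral_eq_zero_iff_of_nonneg (fun x => sq_nonneg (inner ℝ a x)) hint).1 h0.symm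
    filter_upwards [this] with x hx
    simpa using hx
  have hsupp : P.support ⊆ {x | inner ℝ a x = 0} :=
    Measure.support_subset_of_isClosed (isClosed_eq (by fun_prop) (by fun_prop)) hae
  have hker : ∀ x : EucSp m, x ∈ LinearMap.ker (innerₗ (EucSp m) a) := by
    have htop : (⊤ : Submodule ℝ (EucSp m)) ≤ LinearMap.ker (innerₗ (EucSp m) a) := by
      rw [← IsZLattice.span_top (K := ℝ) (L := Λ), Submodule.span_le, hΛ]
      intro x hx
      induction hx using Submodule.span_induction with
      | mem x hx => exact hsupp hx
      | zero => exact Submodule.zero_mem _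
      | add x y _ _ hx hy => exact Submodule.add_mem _ hx hy
      | smul c x _ hx =>
        rw [← Int.cast_smul_eq_zsmul ℝ]
        exact Submodule.smul_mem _ _ hx
    exact fun x => htop trivial
  have : a = 0 := inner_self_eq_zero.1 (hker a)
  simpa [ha] using this

theorem sqrtSecondMoment_isHermitian (P : Measure (EucSp m)) :
    (sqrtSecondMoment P).IsHermitian :=
  (Matrix.nonneg_iff_posSemidef.1 (CFC.sqrt_nonneg _)).isHermitian

end

section
variable {m : ℕ} {P : Measure (EucSp m)}

theorem sqrtSecondMoment_mul_self (hP : (secondMoment P).PosDef) :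
    sqrtSecondMoment P * sqrtSecondMoment P = secondMoment P :=
  CFC.sqrt_mul_sqrt_self _ (Matrix.nonneg_iff_posSemidef.2 hP.posSemidef)

theorem sqrtSecondMoment_det_sq (hP : (secondMoment P).PosDef) :
    (sqrtSecondMoment P).det ^ 2 = (secondMoment P).det := by
  rw [sq, ← Matrix.det_mul, sqrtSecondMoment_mul_self hP]

theorem isUnit_sqrtSecondMoment_det (hP : (secondMoment P).PosDef) :
    IsUnit (sqrtSecondMoment P).det := by
  rw [isUnit_iff_ne_zero]
  intro h
  have := sqrtSecondMoment_det_sq hP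
  rw [h] at this
  exact hP.det_pos.ne' (by rw [← this]; simp)

theorem whiten_sqrtSecondMoment (hP : (secondMoment P).PosDef) (x : EucSp m) :
    whiten P (Matrix.toEuclideanLin (sqrtSecondMoment P) x) = x := by
  rw [whiten, ← LinearMap.comp_apply, ← Matrix.toLpLin_mul,
    Matrix.nonsing_inv_mul _ (isUnit_sqrtSecondMoment_det hP), Matrix.toLpLin_one]
  rfl

theorem sqrtSecondMoment_whiten (hP : (secondMoment P).PosDef) (x : EucSp m) :
    Matrix.toEuclideanLin (sqrtSecondMoment P) (whiten P x) = x := by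
  rw [whiten, ← LinearMap.comp_apply, ← Matrix.toLpLin_mul,
    Matrix.mul_nonsing_inv _ (isUnit_sqrtSecondMoment_det hP), Matrix.toLpLin_one]
  rfl

/-- The invertible linear map `Σ^{-1/2}`. -/
noncomputable def whitenEquiv (hP : (secondMoment P).PosDef) : EucSp m ≃ₗ[ℝ] EucSp m :=
  LinearEquiv.ofLinearMap (whiten P) (Matrix.toEuclideanLin (sqrtSecondMoment P))
    (LinearMap.ext (whiten_sqrtSecondMoment hP)) (LinearMap.ext (sqrtSecondMoment_whiten hP))

theorem coe_whitenEquiv (hP : (secondMoment P).PosDef) : ⇑(whitenEquiv hP) = whiten P := rfl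

theorem inner_sqrtSecondMoment (a b : EucSp m) :
    inner ℝ (Matrix.toEuclideanLin (sqrtSecondMoment P) a) b =
      inner ℝ a (Matrix.toEuclideanLin (sqrtSecondMoment P) b) :=
  Matrix.isSymmetric_toEuclideanLin_iff.2 (sqrtSecondMoment_isHermitian P) a b

theorem inner_whiten (a b : EucSp m) :
    inner ℝ (whiten P a) b = inner ℝ a (whiten P b) :=
  Matrix.isSymmetric_toEuclideanLin_iff.2 (sqrtSecondMoment_isHermitian P).inv a b

theorem secondMoment_apply_eq (hP : (secondMoment P).PosDef) (x : EucSp m) :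
    Matrix.toEuclideanLin (secondMoment P) x =
      Matrix.toEuclideanLin (sqrtSecondMoment P)
        (Matrix.toEuclideanLin (sqrtSecondMoment P) x) := by
  rw [← LinearMap.comp_apply, ← Matrix.toLpLin_mul, sqrtSecondMoment_mul_self hP]

theorem leastEigenvalue_le (hP : (secondMoment P).PosDef) :
    ∀ x ∈ spectrum ℝ (secondMoment P), leastEigenvalue P ≤ x := by
  intro x hx
  refine csInf_le ?_ hx
  rw [hP.isHermitian.spectrum_real_eq_range_eigenvalues]
  exact (Set.finite_range _).bddBelow

theorem leastEigenvalue_pos (hm : 1 ≤ m) (hP : (secondMoment P).PosDef) :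
    0 < leastEigenvalue P := by
  have : Nonempty (Fin m) := ⟨⟨0, hm⟩⟩
  have hmem : leastEigenvalue P ∈ spectrum ℝ (secondMoment P) := by
    unfold leastEigenvalue
    rw [hP.isHermitian.spectrum_real_eq_range_eigenvalues]
    exact (Set.range_nonempty _).csInf_mem (Set.finite_range _)
  rw [hP.isHermitian.spectrum_real_eq_range_eigenvalues] at hmem
  obtain ⟨i, hi⟩ := hmem
  rw [← hi]
  exact hP.eigenvalues_pos i

theorem leastEigenvalue_mul_norm_sq_le (hP : (secondMoment P).PosDef) (w : EucSp m) :
    leastEigenvalue P * ‖w‖ ^ 2 ≤ inner ℝ w (Matrix.toEuclideanLin (secondMoment P) w) := by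
  have hle : algebraMap ℝ (Matrix (Fin m) (Fin m) ℝ) (leastEigenvalue P) ≤ secondMoment P :=
    (algebraMap_le_iff_le_spectrum (a := secondMoment P)
      (ha := hP.isHermitian.isSelfAdjoint)).2 (leastEigenvalue_le hP)
  have h := (Matrix.le_iff.1 hle).dotProduct_mulVec_nonneg w
  have h2 : star (w : Fin m → ℝ) ⬝ᵥ ((secondMoment P - algebraMap ℝ (Matrix (Fin m) (Fin m) ℝ)
      (leastEigenvalue P)) *ᵥ w) =
      inner ℝ w (Matrix.toEuclideanLin (secondMoment P) w) - leastEigenvalue P * ‖w‖ ^ 2 := by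
    rw [← real_inner_self_eq_norm_sq, PiLp.inner_apply, PiLp.inner_apply, Matrix.sub_mulVec,
      dotProduct_sub, Algebra.algebraMap_eq_smul_one, Matrix.smul_mulVec, Matrix.one_mulVec,
      dotProduct_smul]
    simp [dotProduct, mul_comm]
    exact Or.inl (Finset.sum_congr rfl fun _ _ => (sq _).symm)
  rw [h2] at h
  linarith

theorem norm_whiten_sq_le (hm : 1 ≤ m) (hP : (secondMoment P).PosDef) (x : EucSp m) :
    ‖whiten P x‖ ^ 2 ≤ ‖x‖ ^ 2 / leastEigenvalue P := by
  rw [le_div_iff₀ (leastEigenvalue_pos hm hP), mul_comm]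
  refine (leastEigenvalue_mul_norm_sq_le hP _).trans (le_of_eq ?_)
  rw [secondMoment_apply_eq hP, ← inner_sqrtSecondMoment, sqrtSecondMoment_whiten hP,
    real_inner_self_eq_norm_sq]

theorem ae_whitenedLaw (hP : (secondMoment P).PosDef) {Λ : Submodule ℤ (EucSp m)}
    (hΛ : Λ = Submodule.span ℤ P.support) (hΛc : IsClosed (whitenedLattice P Λ : Set (EucSp m)))
    {L : ℝ} (hL : P.support ⊆
      Matrix.toEuclideanLin (sqrtSecondMoment P) '' Metric.closedBall 0 L) :
    ∀ᵐ z ∂whitenedLaw P, z ∈ whitenedLattice P Λ ∧ ‖z‖ ≤ L := by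
  have hmeas : Measurable (whiten P) :=
    (LinearMap.continuous_of_finiteDimensional (whiten P)).measurable
  have hset : MeasurableSet {z : EucSp m | z ∈ whitenedLattice P Λ ∧ ‖z‖ ≤ L} :=
    hΛc.measurableSet.inter (isClosed_le continuous_norm continuous_const).measurableSet
  rw [whitenedLaw, ae_map_iff hmeas.aemeasurable hset]
  filter_upwards [P.support_mem_ae] with x hx
  refine ⟨⟨x, ?_, rfl⟩, ?_⟩
  · rw [hΛ]; exact Submodule.subset_span hx
  · obtain ⟨b, hb, rfl⟩ := hL hx
    rw [whiten_sqrtSecondMoment hP]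
    simpa using hb

theorem whitenedLaw_isotropic [IsProbabilityMeasure P] (hP : (secondMoment P).PosDef) {K : ℝ}
    (hK : ∀ᵐ x ∂P, ‖x‖ ≤ K) (j k : Fin m) :
    ∫ z, z j * z k ∂whitenedLaw P = if j = k then 1 else 0 := by
  have hmeas : Measurable (whiten P) :=
    (LinearMap.continuous_of_finiteDimensional (whiten P)).measurable
  have hco : ∀ (i : Fin m) (x : EucSp m), (whiten P x) i =
      inner ℝ (whiten P (EuclideanSpace.single i 1)) x := fun i x => by
    rw [inner_whiten, EuclideanSpace.inner_single_left]; simp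
  rw [whitenedLaw, integral_map hmeas.aemeasurable (by fun_prop)]
  simp_rw [hco]
  rw [← inner_secondMoment hK, secondMoment_apply_eq hP, sqrtSecondMoment_whiten hP, inner_whiten,
    whiten_sqrtSecondMoment hP, EuclideanSpace.inner_single_left]
  simp

/-- The whitened lattice has an `ℝ`-basis of `ℝ^m` as `ℤ`-basis, and covolume
`det Λ / √(det Σ)`. -/
theorem exists_basis_whitenedLattice (hP : (secondMoment P).PosDef)
    (Λ : Submodule ℤ (EucSp m)) [DiscreteTopology Λ] [IsZLattice ℝ Λ] :
    ∃ e : Basis (Fin m) ℝ (EucSp m), whitenedLattice P Λ = Submodule.span ℤ (Set.range e) ∧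
      (volume : Measure (EucSp m)).real (ZSpan.fundamentalDomain e) =
        ZLattice.covolume Λ / √(secondMoment P).det := by
  have hfree : Module.Free ℤ Λ := ZLattice.module_free ℝ Λ
  have hfinite : Module.Finite ℤ Λ := ZLattice.module_finite ℝ Λ
  have hrank : finrank ℤ Λ = m := by rw [ZLattice.rank ℝ Λ]; simp
  let b : Basis (Fin m) ℤ Λ := finBasisOfFinrankEq ℤ Λ hrank
  refine ⟨(b.ofZLatticeBasis ℝ Λ).map (whitenEquiv hP), ?_, ?_⟩
  · rw [← ZSpan.map, Module.Basis.ofZLatticeBasis_span]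
    rfl
  · rw [← ZSpan.map_fundamentalDomain, measureReal_def]
    have himg : volume (whitenEquiv hP '' ZSpan.fundamentalDomain (b.ofZLatticeBasis ℝ Λ)) =
        ENNReal.ofReal |LinearMap.det (whiten P)| *
          volume (ZSpan.fundamentalDomain (b.ofZLatticeBasis ℝ Λ)) :=
      Measure.addHaar_image_linearMap volume (whiten P) _
    rw [himg, ENNReal.toReal_mul, ENNReal.toReal_ofReal (abs_nonneg _), ← measureReal_def,
      ← ZLattice.covolume_eq_measure_fundamentalDomain Λ volume
        (ZLattice.isAddFundamentalDomain b volume), mul_comm, div_eq_mul_inv]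
    congr 1
    have hdet : LinearMap.det (whiten P) = (sqrtSecondMoment P).det⁻¹ := by
      rw [whiten, LinearMap.det_toLpLin, Matrix.det_nonsing_inv, Ring.inverse_eq_inv]
    rw [hdet, ← sqrtSecondMoment_det_sq hP, sqrt_sq_eq_abs, abs_inv]

theorem one_le_of_isotropic (hm : 1 ≤ m) (Q : Measure (EucSp m)) [IsProbabilityMeasure Q] {L : ℝ}
    (hQL : ∀ᵐ z ∂Q, ‖z‖ ≤ L)
    (hQ : ∀ j k : Fin m, ∫ z, z j * z k ∂Q = if j = k then 1 else 0) : 1 ≤ L := by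
  have hL0 : 0 ≤ L := by
    obtain ⟨z, hz⟩ := hQL.exists
    exact (norm_nonneg z).trans hz
  have hint := integrable_coord_mul hQL
  have h : ∫ z, z ⟨0, hm⟩ * z ⟨0, hm⟩ ∂Q ≤ ∫ _, L ^ 2 ∂Q := by
    refine integral_mono_ae (hint _ _) (integrable_const _) ?_
    filter_upwards [hQL] with z hz
    have h0 : |z ⟨0, hm⟩| ≤ L := (by simpa using PiLp.norm_apply_le z ⟨0, hm⟩ : _ ≤ ‖z‖).trans hz
    rw [← abs_mul_abs_self, ← sq]
    gcongr
  rw [hQ] at h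
  simp at h
  rwa [abs_of_nonneg hL0] at h

end

/-! ### Norms, covering radii and the thresholds -/

section
variable {m : ℕ}

theorem exists_seminorm_le_mul_norm (p : Seminorm ℝ (EucSp m)) :
    ∃ C : ℝ, ∀ x, p x ≤ C * ‖x‖ := by
  refine ⟨∑ i, p (EuclideanSpace.single i 1), fun x => ?_⟩
  have hx : x = ∑ i, x i • EuclideanSpace.single i (1 : ℝ) := by
    conv_lhs => rw [← (EuclideanSpace.basisFun (Fin m) ℝ).sum_repr x]
    simp
  calc p x = p (∑ i, x i • EuclideanSpace.single i (1 : ℝ)) := by rw [← hx]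
    _ ≤ ∑ i, p (x i • EuclideanSpace.single i (1 : ℝ)) :=
        Finset.le_sum_of_subadditive p (map_zero p).le (map_add_le_add p) _ _
    _ ≤ ∑ i, p (EuclideanSpace.single i 1) * ‖x‖ := by
        refine Finset.sum_le_sum fun i _ => ?_
        rw [map_smul_eq_mul, mul_comm]
        gcongr
        exact PiLp.norm_apply_le x i
    _ = _ := by rw [Finset.sum_mul]

theorem seminorm_continuous (p : Seminorm ℝ (EucSp m)) : Continuous p := by
  obtain ⟨C, hC⟩ := exists_seminorm_le_mul_norm p
  refine Seminorm.continuous_of_continuousAt_zero ?_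
  rw [ContinuousAt, map_zero]
  refine squeeze_zero (fun x => apply_nonneg p x) hC ?_
  have : Continuous fun x : EucSp m => C * ‖x‖ := by fun_prop
  simpa using this.tendsto 0

theorem norm_le_distortion_mul {p : Seminorm ℝ (EucSp m)} (hp : IsNormOn p) (x : EucSp m) :
    ‖x‖ ≤ distortion p * p x := by
  rcases eq_or_ne x 0 with rfl | hx
  · simp
  have hpos : ∀ y : EucSp m, y ≠ 0 → 0 < p y := fun y hy =>
    (apply_nonneg p y).lt_of_ne fun h => hy (hp y h.symm)
  have hunit : ∀ y : EucSp m, y ≠ 0 → ‖‖y‖⁻¹ • y‖ = 1 := fun y hy => by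
    rw [norm_smul, norm_inv, norm_norm, inv_mul_cancel₀ (norm_ne_zero_iff.2 hy)]
  obtain ⟨y₀, hy₀, hmin⟩ := (isCompact_sphere (0 : EucSp m) 1).exists_isMinOn
    ⟨‖x‖⁻¹ • x, by simpa using hunit x hx⟩ (seminorm_continuous p).continuousOn
  have hy₀' : y₀ ≠ 0 := by
    rintro rfl
    simp at hy₀
  have hbdd : BddAbove {r : ℝ | ∃ x : EucSp m, p x = 1 ∧ r = ‖x‖} := by
    refine ⟨(p y₀)⁻¹, ?_⟩
    rintro _ ⟨y, hy, rfl⟩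
    have hy0 : y ≠ 0 := by
      rintro rfl
      simp at hy
    have h1 : p y₀ ≤ p (‖y‖⁻¹ • y) := hmin (by simpa using hunit y hy0)
    rw [map_smul_eq_mul, hy, mul_one, norm_inv, norm_norm] at h1
    exact (le_inv_comm₀ (hpos _ hy₀') (norm_pos_iff.2 hy0)).1 h1
  have hpx := hpos x hx
  have h2 : ‖(p x)⁻¹ • x‖ ≤ distortion p := by
    refine le_csSup hbdd ⟨_, ?_, rfl⟩
    rw [map_smul_eq_mul, norm_inv, norm_eq_abs, abs_of_pos hpx, inv_mul_cancel₀ hpx.ne']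
  rw [norm_smul, norm_inv, norm_eq_abs, abs_of_pos hpx, inv_mul_le_iff₀ hpx] at h2
  rwa [mul_comm]

theorem distortion_pos (hm : 1 ≤ m) {p : Seminorm ℝ (EucSp m)} (hp : IsNormOn p) :
    0 < distortion p := by
  have hx : EuclideanSpace.single (⟨0, hm⟩ : Fin m) (1 : ℝ) ≠ 0 := by simp
  have h := norm_le_distortion_mul hp (EuclideanSpace.single (⟨0, hm⟩ : Fin m) (1 : ℝ))
  by_contra! hle
  have := mul_nonpos_of_nonpos_of_nonneg hle (apply_nonneg p (EuclideanSpace.single ⟨0, hm⟩ 1))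
  exact hx (norm_le_zero_iff.1 (h.trans this))

/-- The covering radius bounds all distances, as a full lattice spans the space. -/
theorem normDist_le_coveringRadius (p : Seminorm ℝ (EucSp m)) (Λ : Submodule ℤ (EucSp m))
    [DiscreteTopology Λ] [IsZLattice ℝ Λ] (x : EucSp m) :
    ENNReal.ofReal (normDist p x Λ) ≤ coveringRadius p (Λ : Set (EucSp m)) := by
  refine le_iSup₂ (f := fun (x : EucSp m) (_ : x ∈ Submodule.span ℝ (Λ : Set (EucSp m))) =>
    ENNReal.ofReal (normDist p x Λ)) x ?_
  rw [IsZLattice.span_top]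
  trivial

theorem normDist_doubled (p : Seminorm ℝ (EucSp m)) (Λ : Submodule ℤ (EucSp m)) (x : EucSp m) :
    normDist p x (doubled Λ) = 2 * normDist p ((1 / 2 : ℝ) • x) Λ := by
  unfold normDist
  rw [Real.mul_iInf_of_nonneg zero_le_two]
  symm
  refine Function.Surjective.iInf_congr
    (fun y : (Λ : Set (EucSp m)) => (⟨(2 : ℝ) • (y : EucSp m), y, y.2, rfl⟩ : doubled Λ)) ?_ ?_
  · rintro ⟨_, y, hy, rfl⟩
    exact ⟨⟨y, hy⟩, rfl⟩
  · intro y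
    have h : x - (2 : ℝ) • (y : EucSp m) = (2 : ℝ) • ((1 / 2 : ℝ) • x - (y : EucSp m)) := by
      rw [smul_sub, smul_smul]; norm_num
    rw [h, map_smul_eq_mul]
    simp

theorem exists_seminorm_sub_lt {p : Seminorm ℝ (EucSp m)} {x : EucSp m} {S : Set (EucSp m)}
    (hS : S.Nonempty) {b : ℝ} (hb : normDist p x S < b) : ∃ y ∈ S, p (x - y) < b := by
  have := hS.to_subtype
  obtain ⟨y, hy⟩ := exists_lt_of_ciInf_lt hb
  exact ⟨y, y.2, hy⟩

/-- A set whose lattice translates cover the space has at least the volume of a fundamental domain. -/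
theorem volume_le_of_cover {E : Type*} [NormedAddCommGroup E] [NormedSpace ℝ E]
    [MeasurableSpace E] [BorelSpace E] [FiniteDimensional ℝ E]
    {μ : Measure E} [μ.IsAddHaarMeasure] {ι : Type*} [Finite ι]
    (e : Basis ι ℝ E) {s : Set E}
    (hs : ∀ x, ∃ g ∈ Submodule.span ℤ (Set.range e), x - g ∈ s) :
    μ (ZSpan.fundamentalDomain e) ≤ μ s := by
  have : VAddInvariantMeasure (Submodule.span ℤ (Set.range e)) E μ :=
    inferInstanceAs (VAddInvariantMeasure (Submodule.span ℤ (Set.range e)).toAddSubgroup E μ)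
  rw [(ZSpan.isAddFundamentalDomain e μ).measure_eq_tsum s]
  refine le_trans (measure_mono fun x hx => ?_) (measure_iUnion_le _)
  obtain ⟨g, hg, hxg⟩ := hs x
  refine Set.mem_iUnion.2 ⟨⟨g, hg⟩, ⟨x - g, hxg, ?_⟩, hx⟩
  simp [Submodule.vadd_def]

/-- A ball is contained in a cube. -/
theorem volume_ball_le (s : ℝ) :
    volume (Metric.ball (0 : EucSp m) s) ≤ ENNReal.ofReal (2 * s) ^ m := by
  have hsub : Metric.ball (0 : EucSp m) s ⊆
      (MeasurableEquiv.toLp 2 (Fin m → ℝ)).symm ⁻¹' (Set.univ.pi fun _ => Set.Icc (-s) s) := by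
    intro x hx i _
    have h1 : ‖x i‖ ≤ ‖x‖ := PiLp.norm_apply_le x i
    have h2 : ‖x‖ < s := by simpa using hx
    exact abs_le.1 (h1.trans h2.le)
  refine (measure_mono hsub).trans ?_
  rw [(EuclideanSpace.volume_preserving_symm_measurableEquiv_toLp (Fin m)).measure_preimage
    (MeasurableSet.univ_pi fun _ => measurableSet_Icc).nullMeasurableSet, volume_pi_pi]
  simp [two_mul]

section Thresholds
variable {p : Seminorm ℝ (EucSp m)} {P : Measure (EucSp m)} {Λ : Submodule ℤ (EucSp m)}
  {c L : ℝ} {n : ℕ}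

theorem coveringRadius_of_threshold_le (hc : 0 < c)
    (hR : 0 < distortion p ^ 2 / leastEigenvalue P) (h : threshold c 1 p P Λ L ≤ n) :
    coveringRadius p (Λ : Set (EucSp m)) ≠ ∞ ∧
      c * (distortion p ^ 2 / leastEigenvalue P *
        (coveringRadius p (Λ : Set (EucSp m))).toReal ^ 2) ≤ n := by
  have h1 : ENNReal.ofReal c * (ENNReal.ofReal (distortion p ^ 2 / leastEigenvalue P) *
      coveringRadius p (Λ : Set (EucSp m)) ^ 2) ≤ n :=
    (mul_le_mul_right (le_max_left _ _) _).trans h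
  have hfin : coveringRadius p (Λ : Set (EucSp m)) ≠ ∞ := fun htop => by
    rw [htop, ENNReal.top_pow two_ne_zero, ENNReal.mul_top (by simpa using hR),
      ENNReal.mul_top (by simpa using hc)] at h1
    exact (ENNReal.natCast_ne_top n) (top_le_iff.1 h1)
  refine ⟨hfin, ?_⟩
  rw [← ENNReal.ofReal_toReal hfin, ← ENNReal.ofReal_pow ENNReal.toReal_nonneg,
    ← ENNReal.ofReal_mul hR.le, ← ENNReal.ofReal_mul hc.le, ENNReal.ofReal_le_natCast] at h1
  exact h1

theorem dimension_of_threshold_le (hc : 0 < c) (h : threshold c 1 p P Λ L ≤ n) :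
    c * ((m : ℝ) ^ 2 * L ^ 2 * (log m + log L) ^ 2) ≤ n := by
  have h1 : ENNReal.ofReal c * ENNReal.ofReal ((m : ℝ) ^ 2 * L ^ 2 * (log m + log L) ^ 2) ≤ n := by
    refine le_trans (mul_le_mul_right ?_ _) h
    refine le_trans ?_ (le_max_right _ _)
    rw [thresholdZero, ENNReal.ofReal_one, one_mul]
    exact le_max_left _ _
  rwa [← ENNReal.ofReal_mul hc.le, ENNReal.ofReal_le_natCast] at h1

theorem covolume_of_threshold_le (hc : 0 < c) (h : threshold c 1 p P Λ L ≤ n) :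
    c * (L ^ 2 * log (ZLattice.covolume Λ / √(secondMoment P).det) ^ 2) ≤ n := by
  have h1 : ENNReal.ofReal c *
      ENNReal.ofReal (L ^ 2 * log (ZLattice.covolume Λ / √(secondMoment P).det) ^ 2) ≤ n := by
    refine le_trans (mul_le_mul_right ?_ _) h
    refine le_trans ?_ (le_max_right _ _)
    rw [thresholdZero, ENNReal.ofReal_one, one_mul]
    exact (le_max_right _ _).trans (le_max_right _ _)
  rwa [← ENNReal.ofReal_mul hc.le, ENNReal.ofReal_le_natCast] at h1

/-- The spanningness term of the threshold, spelled out at a pseudodual vector. In particular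
`Z̃(θ)` does not vanish there, since then the threshold would be infinite. -/
theorem spanningness_of_threshold_le (hc : 0 < c) (hL : 0 < L) (h : threshold c 1 p P Λ L ≤ n)
    {θ : EucSp m} (hθ : θ ∉ dualLattice (whitenedLattice P Λ))
    (hps : IsPseudodual (whitenedLaw P) (whitenedLattice P Λ) θ) :
    c ≤ n * L ^ 2 * tildeFn (whitenedLaw P) θ ^ 4 := by
  set T := tildeFn (whitenedLaw P) θ with hT
  have hT0 : 0 ≤ T := sqrt_nonneg _
  have hs : spanningness (whitenedLaw P) (whitenedLattice P Λ) ≤ ENNReal.ofReal T :=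
    iInf₂_le θ ⟨hθ, hps⟩
  have h1 : ENNReal.ofReal c * ((ENNReal.ofReal T)⁻¹ ^ 4 * ENNReal.ofReal (L⁻¹ ^ 2)) ≤ n := by
    refine le_trans (mul_le_mul_right ?_ _) h
    refine le_trans ?_ (le_max_right _ _)
    rw [thresholdZero, ENNReal.ofReal_one, one_mul]
    refine le_trans ?_ ((le_max_left _ _).trans (le_max_right _ _))
    gcongr
  rcases hT0.eq_or_lt with h0 | h0
  · rw [← h0, ENNReal.ofReal_zero, ENNReal.inv_zero, ENNReal.top_pow (by norm_num),
      ENNReal.top_mul (by simp; positivity), ENNReal.mul_top (by simpa using hc)] at h1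
    exact absurd (top_le_iff.1 h1) (ENNReal.natCast_ne_top n)
  · rw [← ENNReal.ofReal_inv_of_pos h0, ← ENNReal.ofReal_pow (by positivity),
      ← ENNReal.ofReal_mul (by positivity), ← ENNReal.ofReal_mul hc.le,
      ENNReal.ofReal_le_natCast] at h1
    calc c = c * (T⁻¹ ^ 4 * L⁻¹ ^ 2) * (L ^ 2 * T ^ 4) := by field_simp
      _ ≤ n * (L ^ 2 * T ^ 4) := by gcongr
      _ = _ := by ring

end Thresholds

end

/-! ### The number of columns is large, and the conclusion -/

section
variable {m : ℕ} {P : Measure (EucSp m)} {Λ : Submodule ℤ (EucSp m)}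

/-- If `R_*² ρ_*² / σ` is small, then the translates of a small ball by the whitened lattice cover the
space, so that its covolume is less than `1 / e`. -/
theorem one_le_abs_log_of_cover (hm : 1 ≤ m) (hP : (secondMoment P).PosDef)
    {p : Seminorm ℝ (EucSp m)} (hp : IsNormOn p) [DiscreteTopology Λ] [IsZLattice ℝ Λ]
    (hfin : coveringRadius p (Λ : Set (EucSp m)) ≠ ∞)
    (ht : distortion p ^ 2 / leastEigenvalue P *
      (coveringRadius p (Λ : Set (EucSp m))).toReal ^ 2 < 1 / 32)
    {e : Basis (Fin m) ℝ (EucSp m)} (he : whitenedLattice P Λ = Submodule.span ℤ (Set.range e)) :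
    1 ≤ |log ((volume : Measure (EucSp m)).real (ZSpan.fundamentalDomain e))| := by
  set ρ := (coveringRadius p (Λ : Set (EucSp m))).toReal with hρ
  set D := (volume : Measure (EucSp m)).real (ZSpan.fundamentalDomain e) with hD
  set R := distortion p with hR
  have hR0 : 0 < R := distortion_pos hm hp
  have hσ := leastEigenvalue_pos hm hP
  have hρ0 : 0 ≤ ρ := ENNReal.toReal_nonneg
  -- the covering radius of the whitened lattice is below `9 / 50`
  have hcov : ∀ x, ∃ g ∈ Submodule.span ℤ (Set.range e),
      x - g ∈ Metric.ball (0 : EucSp m) (9 / 50) := by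
    intro x
    set y := Matrix.toEuclideanLin (sqrtSecondMoment P) x with hy
    have hlt : R * ρ < √(leastEigenvalue P) * (9 / 50) := by
      rw [← abs_of_nonneg (show 0 ≤ R * ρ by positivity),
        ← abs_of_nonneg (show 0 ≤ √(leastEigenvalue P) * (9 / 50) by positivity), ← sq_lt_sq,
        mul_pow, mul_pow, sq_sqrt hσ.le]
      rw [div_mul_eq_mul_div, div_lt_iff₀ hσ] at ht
      linarith
    have hlt' : ρ < √(leastEigenvalue P) * (9 / 50) / R := by
      rw [lt_div_iff₀ hR0]; linarith
    have hnd : normDist p y Λ ≤ ρ := by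
      have := normDist_le_coveringRadius p Λ y
      rwa [ENNReal.ofReal_le_iff_le_toReal hfin] at this
    obtain ⟨g, hg, hpg⟩ := exists_seminorm_sub_lt (S := (Λ : Set (EucSp m))) ⟨0, Λ.zero_mem⟩
      (hnd.trans_lt hlt')
    refine ⟨whiten P g, he ▸ ⟨g, hg, rfl⟩, ?_⟩
    rw [mem_ball_zero_iff]
    have h1 : x - whiten P g = whiten P (y - g) := by
      rw [map_sub, hy, whiten_sqrtSecondMoment hP]
    have h2 : ‖y - g‖ < √(leastEigenvalue P) * (9 / 50) := by
      refine (norm_le_distortion_mul hp _).trans_lt ?_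
      rw [lt_div_iff₀ hR0] at hpg
      linarith
    have h3 : ‖x - whiten P g‖ ^ 2 < (9 / 50) ^ 2 := by
      rw [h1]
      refine (norm_whiten_sq_le hm hP _).trans_lt ?_
      rw [div_lt_iff₀ hσ]
      calc ‖y - g‖ ^ 2 < (√(leastEigenvalue P) * (9 / 50)) ^ 2 := by gcongr
        _ = _ := by rw [mul_pow, sq_sqrt hσ.le]; ring
    exact lt_of_pow_lt_pow_left₀ 2 (by norm_num) h3
  have hvol : D ≤ 9 / 25 := by
    have h1 := (volume_le_of_cover (μ := volume) e hcov).trans (volume_ball_le (9 / 50))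
    have h2 : D ≤ (2 * (9 / 50) : ℝ) ^ m := by
      rw [hD, measureReal_def]
      refine ENNReal.toReal_le_of_le_ofReal (by positivity) ?_
      rwa [ENNReal.ofReal_pow (by norm_num)]
    refine h2.trans ((pow_le_of_le_one (by norm_num) (by norm_num) (by lia)).trans (by norm_num))
  have hD0 : 0 < D := ENNReal.toReal_pos (ZSpan.measure_fundamentalDomain_ne_zero e)
    (ZSpan.fundamentalDomain_isBounded e).measure_lt_top.ne
  have hlog : log D ≤ -1 := by
    rw [log_le_iff_le_exp hD0]
    have := exp_neg_one_gt_d9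
    linarith
  rw [le_abs]
  right; linarith

/-- The summand `1` next to the logarithms is harmless: if the logarithms are small, then `m = 1` and
`L` is bounded, and the constant lower bound for `N` takes over. -/
theorem sqrt_ge_of_threshold {m : ℕ} {L N : ℝ} (hm : 1 ≤ m) (hL : 1 ≤ L) (hN : 4 * 10 ^ 6 ≤ N)
    (h : 128 * 10 ^ 6 * ((m : ℝ) ^ 2 * L ^ 2 * (log m + log L) ^ 2) ≤ N) :
    1000 * m * L * (1 + log m + log L) ≤ √N := by
  have hm' : (1 : ℝ) ≤ m := by exact_mod_cast hm
  have hlm : 0 ≤ log m := log_nonneg hm'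
  have hlL : 0 ≤ log L := log_nonneg hL
  refine le_sqrt_of_sq_le ?_
  rcases le_or_gt (1 / 4) (log m + log L) with h1 | h1
  · have h2 : (1 + log m + log L) ^ 2 ≤ (5 * (log m + log L)) ^ 2 := by
      apply pow_le_pow_left₀ <;> linarith
    have h3 : 0 ≤ (m : ℝ) ^ 2 * L ^ 2 := by positivity
    have h4 := mul_le_mul_of_nonneg_left h2 h3
    have h5 : 0 ≤ (m : ℝ) ^ 2 * L ^ 2 * (log m + log L) ^ 2 := by positivity
    nlinarith
  · have hlL' : log L < 1 / 4 := by linarith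
    have hm1 : m = 1 := by
      by_contra hne
      have h2 : (2 : ℝ) ≤ m := by exact_mod_cast (show 2 ≤ m by lia)
      have := log_le_log two_pos h2
      have := log_two_gt_d9
      linarith
    subst hm1
    have hL2 : L ^ 2 ≤ 2 := by
      have h2 : log (L ^ 2) ≤ log 2 := by
        rw [log_pow]
        have := log_two_gt_d9
        push_cast
        linarith
      exact (log_le_log_iff (by positivity) two_pos).1 h2
    have h2 : (1 + log (1 : ℕ) + log L) ^ 2 ≤ (5 / 4) ^ 2 := by
      apply pow_le_pow_left₀ <;> linarith
    calc (1000 * ((1 : ℕ) : ℝ) * L * (1 + log (1 : ℕ) + log L)) ^ 2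
        = 10 ^ 6 * (L ^ 2 * (1 + log (1 : ℕ) + log L) ^ 2) := by push_cast; ring
      _ ≤ 10 ^ 6 * (2 * (5 / 4) ^ 2) := by gcongr
      _ ≤ N := by linarith

end

theorem theorem1 :
    ∃ c' c C : ℝ, 0 < c' ∧ 0 < c ∧ 0 < C ∧
      ∀ (m : ℕ) (_ : 1 ≤ m)
        (p : Seminorm ℝ (EucSp m)) (_ : IsNormOn p)
        (Λ : Submodule ℤ (EucSp m)) (_ : DiscreteTopology Λ) (_ : IsZLattice ℝ Λ)
        (P : Measure (EucSp m)) (_ : IsProbabilityMeasure P)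
        (_ : Λ = Submodule.span ℤ P.support)
        (L : ℝ)
        (_ : P.support ⊆ Matrix.toEuclideanLin (sqrtSecondMoment P) '' Metric.closedBall 0 L)
        (n : ℕ) (_ : threshold c' c p P Λ L ≤ (n : ℝ≥0∞)),
        1 - C * (L * Real.sqrt (Real.log n / n)) ≤
          (Measure.pi fun _ : Fin n => P).real
            {x | starDisc p (matrixOfColumns x) ≤ oddDist p (matrixOfColumns x) Λ ∧
              ENNReal.ofReal (oddDist p (matrixOfColumns x) Λ) ≤
                2 * coveringRadius p (Λ : Set (EucSp m))} := by
  -- `10 ^ 6` is the square of the constant `1000` in `exists_signs_whitened`; the factor `128` turns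
  -- the bounds `1 / 32` and `1` of `one_le_abs_log_of_cover` into `4 * 10 ^ 6 ≤ n`.
  refine ⟨128 * 10 ^ 6, 1, 5, by norm_num, one_pos, by norm_num, ?_⟩
  intro m hm p hp Λ _ _ P _ hΛ L hL n hn
  have hc : (0 : ℝ) < 128 * 10 ^ 6 := by norm_num
  obtain ⟨K, hK⟩ := exists_ae_norm_le hL
  have hP := secondMoment_posDef hΛ hK
  have hσ := leastEigenvalue_pos hm hP
  have hR := distortion_pos hm hp
  obtain ⟨hfin, hn1⟩ := coveringRadius_of_threshold_le hc (by positivity) hn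
  have hn2 := dimension_of_threshold_le hc hn
  have hn3 := covolume_of_threshold_le hc hn
  obtain ⟨e, he, hDe⟩ := exists_basis_whitenedLattice hP Λ
  set ρ := (coveringRadius p (Λ : Set (EucSp m))).toReal with hρ
  have hρ0 : 0 ≤ ρ := ENNReal.toReal_nonneg
  rw [← hDe] at hn3
  have hmeas : Measurable (whiten P) :=
    (LinearMap.continuous_of_finiteDimensional (whiten P)).measurable
  have : IsProbabilityMeasure (whitenedLaw P) :=
    Measure.isProbabilityMeasure_map hmeas.aemeasurable
  have hclosed : IsClosed (whitenedLattice P Λ : Set (EucSp m)) := by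
    rw [he]
    exact AddSubgroup.isClosed_of_discrete (H := (Submodule.span ℤ (Set.range e)).toAddSubgroup)
  have hQL := ae_whitenedLaw hP hΛ hclosed hL
  have hQ := whitenedLaw_isotropic hP hK
  have hL1 : 1 ≤ L := one_le_of_isotropic hm _ (hQL.mono fun z hz => hz.2) hQ
  have hL0 : 0 < L := by linarith
  have hN : (4 * 10 ^ 6 : ℝ) ≤ n := by
    rcases lt_or_ge (distortion p ^ 2 / leastEigenvalue P * ρ ^ 2) (1 / 32) with h | h
    · have h1 := one_le_abs_log_of_cover hm hP hp hfin h he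
      set lD := log ((volume : Measure (EucSp m)).real (ZSpan.fundamentalDomain e))
      have h2 : 1 ≤ L ^ 2 * lD ^ 2 := by
        rw [← sq_abs lD]
        nlinarith [mul_le_mul hL1 h1 zero_le_one hL0.le]
      linarith
    · linarith
  have hn0 : (0 : ℝ) < n := by linarith
  have hq0 : 0 < √(n : ℝ) := sqrt_pos.2 hn0
  have h1 := sqrt_ge_of_threshold hm hL1 hN hn2
  have h3 : 1000 * L * |log ((volume : Measure (EucSp m)).real (ZSpan.fundamentalDomain e))| ≤
      √n := by
    refine le_sqrt_of_sq_le ?_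
    rw [mul_pow, sq_abs]
    have : 0 ≤ L ^ 2 * log ((volume : Measure (EucSp m)).real (ZSpan.fundamentalDomain e)) ^ 2 := by
      positivity
    linarith
  have h2 : ∀ θ ∉ dualLattice (Submodule.span ℤ (Set.range e)),
      IsPseudodual (whitenedLaw P) (Submodule.span ℤ (Set.range e)) θ →
        1000 / (L * √n) ≤ tildeFn (whitenedLaw P) θ ^ 2 := by
    intro θ hθ hps
    rw [← he] at hθ hps
    have h4 := spanningness_of_threshold_le hc hL0 hn hθ hps
    refine le_of_sq_le_sq ?_ (sq_nonneg _)
    rw [div_pow, mul_pow, sq_sqrt hn0.le, div_le_iff₀ (by positivity)]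
    nlinarith
  rw [he] at hQL
  obtain ⟨bad, hbad, hgood⟩ := exists_signs_whitened hm (by exact_mod_cast hn0) (whitenedLaw P) e
    hL1 hQL hQ h1 h2 h3
  set W : (Fin n → EucSp m) → (Fin n → EucSp m) := fun x i => whiten P (x i) with hW
  have hWm : Measurable W := measurable_pi_lambda _ fun i => hmeas.comp (measurable_pi_apply i)
  set good : Set (Fin n → EucSp m) :=
    {x | starDisc p (matrixOfColumns x) ≤ oddDist p (matrixOfColumns x) Λ ∧
      ENNReal.ofReal (oddDist p (matrixOfColumns x) Λ) ≤
        2 * coveringRadius p (Λ : Set (EucSp m))} with hgooddef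
  -- `M y` is the signed sum of the columns
  have hMy : ∀ (x : Fin n → EucSp m) (y : Fin n → ℝ),
      WithLp.toLp 2 (matrixOfColumns x *ᵥ y) = ∑ i, y i • x i := by
    intro x y
    ext j
    simp [matrixOfColumns, Matrix.mulVec, dotProduct, mul_comm]
  have hodd : ∀ x : Fin n → EucSp m, ENNReal.ofReal (oddDist p (matrixOfColumns x) Λ) ≤
      2 * coveringRadius p (Λ : Set (EucSp m)) := by
    intro x
    rw [oddDist, normDist_doubled, ENNReal.ofReal_mul zero_le_two]
    gcongr
    · simp
    · exact normDist_le_coveringRadius p Λ _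
  have hsub : (W ⁻¹' bad)ᶜ ⊆ good := by
    intro x hx
    refine ⟨?_, hodd x⟩
    refine le_of_forall_gt fun b hb => ?_
    -- the infimum need not be known to be attained: a slack `δ` in the norm of `v` is affordable
    set δ : ℝ := √(n / (128 * 10 ^ 6)) * √(leastEigenvalue P) / distortion p with hδ
    have hδ0 : 0 < δ := by positivity
    have hlt : oddDist p (matrixOfColumns x) Λ < min b (2 * ρ + δ) := by
      refine lt_min hb ?_
      have h5 := ENNReal.toReal_mono (ENNReal.mul_ne_top ENNReal.ofNat_ne_top hfin) (hodd x)
      rw [ENNReal.toReal_mul, ENNReal.toReal_ofNat] at h5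
      have h6 := le_max_left (oddDist p (matrixOfColumns x) Λ) 0
      rw [← ENNReal.toReal_ofReal'] at h6
      linarith
    obtain ⟨_, ⟨lam, hlam, rfl⟩, hy⟩ :=
      exists_seminorm_sub_lt (S := doubled Λ) ⟨0, 0, Λ.zero_mem, by simp⟩ hlt
    rw [hMy] at hy
    simp only [one_smul] at hy
    set v := ∑ i, x i - (2 : ℝ) • lam with hv
    have hWv : whiten P v = ∑ i, W x i - (2 : ℝ) • whiten P lam := by
      rw [hv, map_sub, map_sum, map_smul]
    have hvn : ‖whiten P v‖ ^ 2 ≤ n / 10 := by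
      set s := √((n : ℝ) / (128 * 10 ^ 6)) with hs
      have hs2 : s ^ 2 = n / (128 * 10 ^ 6) := sq_sqrt (by positivity)
      have hs0 : 0 ≤ s := sqrt_nonneg _
      have h5 : distortion p * ρ ≤ s * √(leastEigenvalue P) := by
        refine le_of_sq_le_sq ?_ (by positivity)
        rw [mul_pow, mul_pow, sq_sqrt hσ.le, hs2]
        rw [div_mul_eq_mul_div, mul_div_assoc', div_le_iff₀ hσ] at hn1
        rw [div_mul_eq_mul_div, le_div_iff₀ hc]
        linarith
      have h6 : ‖v‖ ≤ 3 * (s * √(leastEigenvalue P)) := by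
        refine (norm_le_distortion_mul hp v).trans ?_
        have h7 : p v ≤ 2 * ρ + δ := (hy.trans_le (min_le_right _ _)).le
        calc distortion p * p v ≤ distortion p * (2 * ρ + δ) := by gcongr
          _ = 2 * (distortion p * ρ) + s * √(leastEigenvalue P) := by
              rw [hδ]; field_simp
          _ ≤ _ := by linarith
      refine (norm_whiten_sq_le hm hP v).trans ?_
      rw [div_le_iff₀ hσ]
      calc ‖v‖ ^ 2 ≤ (3 * (s * √(leastEigenvalue P))) ^ 2 := by gcongr
        _ = 9 / (128 * 10 ^ 6) * n * leastEigenvalue P := by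
            rw [mul_pow, mul_pow, sq_sqrt hσ.le, hs2]; ring
        _ ≤ n / 10 * leastEigenvalue P := by gcongr; linarith
    rw [hWv] at hvn
    obtain ⟨y, hyv⟩ := hgood (W x) hx (whiten P lam) (he ▸ ⟨lam, hlam, rfl⟩) hvn
    rw [← hWv] at hyv
    have hyv' : ∑ i, ((y i : ℤ) : ℝ) • x i = v := by
      apply (whitenEquiv hP).injective
      rw [coe_whitenEquiv, map_sum, ← hyv]
      simp [hW]
    have h8 : starDisc p (matrixOfColumns x) ≤ p v := by
      refine (ciInf_le (Set.finite_range _).bddBelow y).trans (le_of_eq ?_)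
      rw [hMy, hyv']
    exact h8.trans_lt (hy.trans_le (min_le_left _ _))
  have hpre : (Measure.pi fun _ : Fin n => P) (W ⁻¹' bad) ≤ ENNReal.ofReal (5 * (L / √n)) := by
    refine le_trans (Measure.le_map_apply hWm.aemeasurable bad) ?_
    have hmap : Measure.map W (Measure.pi fun _ : Fin n => P) =
        Measure.pi fun _ : Fin n => whitenedLaw P := by
      have : ∀ _ : Fin n, SigmaFinite (Measure.map (whiten P) P) := fun _ => by
        change SigmaFinite (whitenedLaw P); infer_instance
      exact Measure.pi_map_pi (μ := fun _ : Fin n => P) (f := fun _ => whiten P)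
        fun _ => hmeas.aemeasurable
    rw [hmap]
    exact hbad
  have hone : (1 : ℝ) ≤ (Measure.pi fun _ : Fin n => P).real good +
      (Measure.pi fun _ : Fin n => P).real (W ⁻¹' bad) := by
    rw [← probReal_univ (μ := Measure.pi fun _ : Fin n => P)]
    refine (measureReal_mono fun x _ => ?_).trans (measureReal_union_le _ _)
    by_cases hx : x ∈ W ⁻¹' bad
    · exact Or.inr hx
    · exact Or.inl (hsub hx)
  have hpre' : (Measure.pi fun _ : Fin n => P).real (W ⁻¹' bad) ≤ 5 * (L / √n) :=
    ENNReal.toReal_le_of_le_ofReal (by positivity) hpre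
  have hlog : L / √n ≤ L * √(log n / n) := by
    rw [div_eq_mul_one_div, ← sqrt_one, ← sqrt_div zero_le_one]
    gcongr
    rw [le_log_iff_exp_le hn0]
    have := exp_one_lt_d9
    linarith
  linarith
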